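/- **Setting.** Let $\mathcal D$ be a probability distribution on $\mathcal X\times\{0,1\}^C$, let $\mathcal S=\{(x^{(n)},y^{(n)})\}_{n\le N}$ be an i.i.d. sample from $\mathcal D$, $N\ge 1$, and let $\mathcal F$ be a (pointwise measurable) class of score functions $f:\mathcal X\to[a,b]^C$ (for example $[a,b]=[0,1]$). For $y\in\{0,1\}^C$ let $\mathcal P(y)=\{i: y_i=1\}$, $N(y)=|\mathcal P(y)|$; let $s_{[k]}$ be the $k$-th largest entry of $s\in\mathbb R^C$. Fix $1\le K<C$ with $N(y)\le K$ almost surely, and a weighting $\alpha=\alpha(N(y))$ with $\alpha(q)\in\{1,\ q,\ q(2K+1-q)/2\}$. The surrogate loss $\ell$ is nonnegative, bounded by $M_\ell$, $\mu_\ell$-Lipschitz, differentiable, strictly decreasing and convex on the interval $[a-b,b-a]$ of all score differences. The TKPR surrogate loss is $$L_K^{\alpha,\ell}(f,y)=\frac1{\alpha K}\sum_{i\in\mathcal P(y)}\sum_{k\le K+1}\ell\big(s_i-s_{[k]}\big),\qquad s=f(x)$$ ($0$ if $N(y)=0$), $\mathcal R(f)$ and $\hat{\mathcal R}_{\mathcal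 S}(f)$ are its expectation under $\mathcal D$ and its mean over $\mathcal S$, and $$\Phi(f,\delta)=\hat{\mathcal R}_{\mathcal S}(f)+3M_K\sqrt{\tfrac{\log(2/\delta)}{2N}},$$ where $M_K=(K+1)M_\ell$ if $\alpha(q)\in\{1,q\}$ and $M_K=\frac{K+1}KM_\ell$ if $\alpha(q)=q(2K+1-q)/2$. For a subsample $\mathcal T\subseteq\mathcal S$ let $\hat{\mathfrak C}_{\mathcal T}(\mathcal F)=\mathbb E_\xi\sup_{f\in\mathcal F}\frac1{|\mathcal T|}\sum_{n\in\mathcal T}\sum_{j\le C}\xi_{nj}f(x^{(n)})_j$, where the $\xi_{nj}$ are independent random signs (Rademacher complexity) or independent standard normal variables (Gaussian complexity). Let $\mathcal S_q$ be the set of sample points with $N(y)=q$ and $\pi_q=|\mathcal S_q|/N$. **Theorem.** There are an absolute constant $c>0$ and a constant $c'(\lambda)$ depending only on $\lambda\in(0,\infty]$ (and non-increasing for $\lambda\ge 3$) such that in every such setting, for every $\delta\in(0,1)$, with probability at least $1-\delta$ over $\mathcal S$ the following holds. Suppose that the empirical complexity is $O(1/\sqrt N)$ with constant $B$ on the sample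 and on its parts: $\hat{\mathfrak C}_{\mathcal S}(\mathcal F)\le B/\sqrt N$ and $\hat{\mathfrak C}_{\mathcal S_q}(\mathcal F)\le B/\sqrt{|\mathcal S_q|}$ for all $1\le q\le K$ with $\mathcal S_q\ne\emptyset$. Then for all $f\in\mathcal F$ $$\mathcal R(f)\le\Phi(f,\delta)+\frac B{\sqrt N}\,\mu_\ell\,A\,\mathfrak g(K),$$ and, if this order is exact, i.e. $\hat{\mathfrak C}_{\mathcal S}(\mathcal F)\ge b/\sqrt N$ for some $b>0$, $$\mathcal R(f)\le\Phi(f,\delta)+\hat{\mathfrak C}_{\mathcal S}(\mathcal F)\,\frac Bb\,\mu_\ell\,A\,\mathfrak g(K),$$ where the pair $(A,\mathfrak g(K))$ may be any of the following. 1. In general: $A=c$ and $\displaystyle \mathfrak g(K)=\sum_{q=1}^K\sqrt{\pi_q}\,\frac{(K+1)\sqrt q+q\sqrt{K+1}}{\alpha(q)K}$. 2. If $\pi_q=\kappa e^{-\lambda q}$ for $1\le q\le K$ with some $\lambda>0$ and $\kappa$: $A=c\max\{1,\sqrt\kappa\}$ and $\mathfrak g(K)=\lambda^{-2}$, $\ e^{-\lambda/2}$,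 $\ K^{-1}e^{-\lambda/2}$ for $\alpha(q)=1$, $\ q$, $\ q(2K+1-q)/2$, respectively. 3. If $K\ge2$ and $\pi_q=\kappa q^{-\lambda}$ for $1\le q\le K$ with some $\lambda\in(0,\infty]$ and $\kappa$ (for $\lambda=\infty$: $\pi_q=0$ for $2\le q\le K$): $A=c'(\lambda)$ and - for $\alpha(q)=1$: $\mathfrak g(K)=K^{(3-\lambda)/2}$ if $\lambda<3$, $\ \ln K$ if $3\le\lambda<5$, $\ 1$ if $\lambda\ge5$; - for $\alpha(q)=q$: $\mathfrak g(K)=K^{(1-\lambda)/2}$ if $\lambda<1$, $\ \ln K$ if $1\le\lambda<3$, $\ 1$ if $\lambda\ge3$; - for $\alpha(q)=q(2K+1-q)/2$: $\mathfrak g(K)=K^{-(1+\lambda)/2}$ if $\lambda<1$, $\ K^{-1}\ln K$ if $1\le\lambda<3$, $\ K^{-1}$ if $\lambda\ge3$. -/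

import Mathlib

open MeasureTheory ProbabilityTheory Filter Topology
open scoped ENNReal NNReal BigOperators

universe u

noncomputable section

namespace TKPR

/-- Label vectors `y ∈ {0,1}^C`; `true` means that the label is relevant. -/
abbrev Labels (C : ℕ) := Fin C → Bool

/-- The set of relevant labels of `y`. -/
def relevant {C : ℕ} (y : Labels C) : Finset (Fin C) :=
  Finset.univ.filter fun i => y i = true

/-- The number `N(y)` of relevant labels of `y`. -/
def count {C : ℕ} (y : Labels C) : ℕ := (relevant y).card

/-- `desc s k` is the entry at position `k` (counted from `0`) when the entries of `s` are sorted
in descending order, i.e. the `(k+1)`-st largest entry `s_[k+1]`. -/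
def desc {C : ℕ} (s : Fin C → ℝ) (k : Fin C) : ℝ := s (Tuple.sort (fun i => -s i) k)

/-- The three weightings `α₁ = 1`, `α₂ = N_K(y)`, `α₃ = N_K(y) (2K + 1 - N_K(y)) / 2`, where
`N_K(y) = min {K, N(y)}`. -/
inductive Weighting
  | alpha1
  | alpha2
  | alpha3

/-- The value `α(q)` of a weighting at a label vector with `q` relevant labels. -/
def Weighting.val (w : Weighting) (K q : ℕ) : ℝ :=
  match w with
  | .alpha1 => 1
  | .alpha2 => (min K q : ℕ)
  | .alpha3 => (min K q : ℕ) * (2 * K + 1 - (min K q : ℕ)) / 2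

/-- The TKPR surrogate loss
`(1 / (α K)) ∑_{i relevant} ∑_{k ≤ K + 1} ℓ (s_i - s_[k])` of a score vector `s`.
It is `0` if there are no relevant labels. -/
def loss {C : ℕ} (w : Weighting) (K : ℕ) (ℓ : ℝ → ℝ) (s : Fin C → ℝ) (y : Labels C) : ℝ :=
  1 / (w.val K (count y) * K) *
    ∑ i ∈ relevant y, ∑ k ∈ Finset.univ.filter (fun k : Fin C => (k : ℕ) < K + 1),
      ℓ (s i - desc s k)

/-- The expected surrogate risk. -/
def risk {X : Type u} [MeasurableSpace X] {C : ℕ} (w : Weighting) (K : ℕ) (ℓ : ℝ → ℝ)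
    (D : Measure (X × Labels C)) (f : X → Fin C → ℝ) : ℝ :=
  ∫ z, loss w K ℓ (f z.1) z.2 ∂D

/-- The empirical surrogate risk on the sample `S`. -/
def empRisk {X : Type u} {C N : ℕ} (w : Weighting) (K : ℕ) (ℓ : ℝ → ℝ)
    (S : Fin N → X × Labels C) (f : X → Fin C → ℝ) : ℝ :=
  1 / (N : ℝ) * ∑ n, loss w K ℓ (f (S n).1) (S n).2

/-- The upper bound `M_K` of the surrogate loss, when `ℓ` is bounded by `M`. -/
def lossBound (w : Weighting) (K : ℕ) (M : ℝ) : ℝ :=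
  match w with
  | .alpha1 => (K + 1) * M
  | .alpha2 => (K + 1) * M
  | .alpha3 => (K + 1) / K * M

/-- `Φ`: the empirical risk plus the confidence term `3 M_K √(log (2/δ) / (2N))`. -/
def Phi {X : Type u} {C N : ℕ} (w : Weighting) (K : ℕ) (ℓ : ℝ → ℝ) (M δ : ℝ)
    (S : Fin N → X × Labels C) (f : X → Fin C → ℝ) : ℝ :=
  empRisk w K ℓ S f + 3 * lossBound w K M * √(Real.log (2 / δ) / (2 * N))

/-- Assumption on the surrogate loss, on the interval `[-r, r]` which contains all differences of
scores: nonnegative, bounded by `M`, `μ`-Lipschitz, differentiable, strictly decreasing and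
convex. (On all of `ℝ`, no function is bounded, strictly decreasing and convex.) -/
structure SurrogateAssumption (ℓ : ℝ → ℝ) (μ : ℝ≥0) (M r : ℝ) : Prop where
  nonneg : ∀ t ∈ Set.Icc (-r) r, 0 ≤ ℓ t
  le_bound : ∀ t ∈ Set.Icc (-r) r, ℓ t ≤ M
  lipschitz : LipschitzOnWith μ ℓ (Set.Icc (-r) r)
  differentiable : DifferentiableOn ℝ ℓ (Set.Icc (-r) r)
  strictAnti : StrictAntiOn ℓ (Set.Icc (-r) r)
  convex : ConvexOn ℝ (Set.Icc (-r) r) ℓ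

/-- The usual measurability condition on a function class: its members are measurable, and each
of them is a pointwise limit of a sequence from a fixed countable subclass. -/
def PointwiseMeasurable {X : Type u} [MeasurableSpace X] {C : ℕ}
    (F : Set (X → Fin C → ℝ)) : Prop :=
  (∀ f ∈ F, Measurable f) ∧
    ∃ F₀ ⊆ F, F₀.Countable ∧ ∀ f ∈ F, ∃ g : ℕ → X → Fin C → ℝ,
      (∀ m, g m ∈ F₀) ∧ ∀ x, Tendsto (fun m => g m x) atTop (𝓝 (f x))

/-- The law of a uniform random sign. -/
def rademacher : Measure ℝ := (2⁻¹ : ℝ≥0∞) • (Measure.dirac 1 + Measure.dirac (-1))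

/-- The empirical complexity
`E_ξ sup_{f ∈ F} (1/|I|) ∑_{n ∈ I} ∑_j ξ_{n j} f_j (x_n)` of the class `F` on the part of the
sample `S` with indices in `I`; the `ξ_{n j}` are independent with law `ν` (Rademacher complexity
for random signs, Gaussian complexity for the standard normal law). -/
def complexity {X : Type u} {C N : ℕ} (ν : Measure ℝ) (F : Set (X → Fin C → ℝ))
    (S : Fin N → X × Labels C) (I : Finset (Fin N)) : ℝ :=
  ∫ ξ : Fin N → Fin C → ℝ,
    (⨆ f : F, 1 / (I.card : ℝ) * ∑ n ∈ I, ∑ j, ξ n j * (f : X → Fin C → ℝ) (S n).1 j)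
    ∂(Measure.pi fun _ => Measure.pi fun _ => ν)

/-- The indices of the sample points with exactly `q` relevant labels (the part `S_q`). -/
def block {X : Type u} {C N : ℕ} (S : Fin N → X × Labels C) (q : ℕ) : Finset (Fin N) :=
  Finset.univ.filter fun n => count (S n).2 = q

/-- The ratio `π_q = N_q / N` of the sample points with exactly `q` relevant labels. -/
def ratio {X : Type u} {C N : ℕ} (S : Fin N → X × Labels C) (q : ℕ) : ℝ :=
  ((block S q).card : ℝ) / N

/-- The assumption that the empirical complexity is `O(1/√(sample size))` with constant `B`,
for the sample `S` and for its parts `S_q`. -/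
def ComplexityRate {X : Type u} {C N : ℕ} (ν : Measure ℝ) (F : Set (X → Fin C → ℝ))
    (S : Fin N → X × Labels C) (K : ℕ) (B : ℝ) : Prop :=
  complexity ν F S Finset.univ ≤ B / √(N : ℝ) ∧
    ∀ q ∈ Finset.Icc 1 K, (block S q).Nonempty →
      complexity ν F S (block S q) ≤ B / √((block S q).card : ℝ)

/-- `g(K) = ∑_{q=1}^K √π_q ((K+1) √q + q √(K+1)) / (α(q) K)`. -/
def rate {X : Type u} {C N : ℕ} (w : Weighting) (K : ℕ) (S : Fin N → X × Labels C) : ℝ :=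
  ∑ q ∈ Finset.Icc 1 K,
    √(ratio S q) * (((K + 1) * √(q : ℝ) + q * √((K : ℝ) + 1)) / (w.val K q * K))

/-- The rates for `π_q ∝ e^{-λ q}`. -/
def expRate (w : Weighting) (K : ℕ) (lam : ℝ) : ℝ :=
  match w with
  | .alpha1 => 1 / lam ^ 2
  | .alpha2 => 1 / Real.exp (lam / 2)
  | .alpha3 => 1 / (K * Real.exp (lam / 2))

/-- The weight `q^{-λ}` for `λ ∈ (0, ∞]`; for `λ = ∞` all mass is at `q = 1`. -/
def powWeight (lam : ℝ≥0∞) (q : ℕ) : ℝ :=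
  if lam = ∞ then (if q = 1 then 1 else 0) else (q : ℝ) ^ (-lam.toReal)

/-- The rates for `π_q ∝ q^{-λ}`. -/
def powRate (w : Weighting) (K : ℕ) (lam : ℝ≥0∞) : ℝ :=
  match w with
  | .alpha1 =>
      if lam < 3 then (K : ℝ) ^ ((3 - lam.toReal) / 2)
      else if lam < 5 then Real.log K else 1
  | .alpha2 =>
      if lam < 1 then (K : ℝ) ^ ((1 - lam.toReal) / 2)
      else if lam < 3 then Real.log K else 1
  | .alpha3 =>
      if lam < 1 then (K : ℝ) ^ (-((1 + lam.toReal) / 2))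
      else if lam < 3 then (K : ℝ)⁻¹ * Real.log K else (K : ℝ)⁻¹

/-- The generalization bound on the sample `S`, for all `f ∈ F`, with implied constant `c` and
rate `g`. The first part is stated for a complexity of exact order `1/√N`, i.e. between `b/√N` and
`B/√N`; the second part needs only the upper bound, and has `B/√N` in place of the complexity. -/
def RiskBound {X : Type u} [MeasurableSpace X] {C N : ℕ} (ν : Measure ℝ)
    (D : Measure (X × Labels C)) (F : Set (X → Fin C → ℝ)) (w : Weighting) (K : ℕ)
    (ℓ : ℝ → ℝ) (μ : ℝ≥0) (M δ : ℝ) (S : Fin N → X × Labels C) (B c g : ℝ) : Prop :=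
  ∀ f ∈ F,
    (∀ b : ℝ, 0 < b → b / √(N : ℝ) ≤ complexity ν F S Finset.univ →
      risk w K ℓ D f ≤
        Phi w K ℓ M δ S f + complexity ν F S Finset.univ * (c * (B / b) * μ * g)) ∧
    risk w K ℓ D f ≤ Phi w K ℓ M δ S f + B / √(N : ℝ) * (c * μ * g)

end TKPR

end

/-! The proof joins a uniform deviation bound, a vector contraction inequality applied separately to
each label count, and elementary estimates of sums.

Deviation. Let `dev` be the supremum over the class of expected minus empirical loss, and `rad` the
empirical Rademacher complexity of the losses. Symmetrization with a ghost sample gives `dev - 2 *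
rad` a nonpositive mean. Replacing one sample point moves it by at most 3M/N, where M bounds the
losses, so one use of `mcdiarmid` yields the term 3M√(log(1/δ)/(2N)), even with 1/δ in place of 2/δ.

Contraction. On the block of points with q relevant labels the loss is Lipschitz in the Euclidean
norm of the score vector with constant μ · `lipConst` (`abs_loss_sub_loss_le`); this rests on
sorting being nonexpansive. `ContractionLaw.contraction` then replaces the losses on that block by
linear forms in the scores at the cost of a factor 2, for random signs and Gaussians alike. Its only
probabilistic input is the Khintchine bound E|X| ≥ (9/16)√(E X²), which follows from second and
fourth moments.

Assembly. A block of size |S_q| contributes 2μ · `lipConst` · (|S_q|/N) · B/√|S_q|, which is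
2(B/√N)μ√π_q · `lipConst`. Summing over q (`rad_loss_le`) and doubling for symmetrization gives
4(B/√N)μ · `rate`. What remains is to bound `rate` for exponential and power-law proportions, where
Σ π_q ≤ 1 controls κ. -/

namespace TKPR

/-! ### McDiarmid's bounded differences inequality -/

section BoundedDifferences

variable {Z : Type*} [MeasurableSpace Z] {N : ℕ}

lemma measurePreserving_cons (D : Measure Z) [SigmaFinite D] (N : ℕ) :
    MeasurePreserving (fun p : Z × (Fin N → Z) => (Fin.cons p.1 p.2 : Fin (N + 1) → Z))
      (D.prod (Measure.pi fun _ => D)) (Measure.pi fun _ => D) := by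
  have h := (measurePreserving_piFinSuccAbove (fun _ : Fin (N + 1) => D) 0).symm
  convert h using 1
  ext p : 1
  exact (Fin.insertNth_zero' p.1 p.2).symm

lemma integral_pi_succ (D : Measure Z) [SigmaFinite D] {F : (Fin (N + 1) → Z) → ℝ}
    (hF : Integrable F (Measure.pi fun _ => D)) :
    ∫ S, F S ∂(Measure.pi fun _ => D) =
      ∫ z, ∫ S, F (Fin.cons z S) ∂(Measure.pi fun _ => D) ∂D := by
  have h := (measurePreserving_piFinSuccAbove (fun _ : Fin (N + 1) => D) 0).symm
  rw [← h.integral_comp (MeasurableEquiv.measurableEmbedding _), integral_prod]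
  · congr! 5
    exact Fin.insertNth_zero' _ _
  · exact (h.integrable_comp_emb (MeasurableEquiv.measurableEmbedding _)).2 hF

lemma integrable_of_abs_le {Ω : Type*} [MeasurableSpace Ω] {P : Measure Ω} [IsFiniteMeasure P]
    {f : Ω → ℝ} (hf : Measurable f) {b : ℝ} (hb : ∀ ω, |f ω| ≤ b) : Integrable f P :=
  Integrable.of_bound hf.aestronglyMeasurable b (ae_of_all _ hb)

lemma abs_integral_le_of_abs_le {Ω : Type*} [MeasurableSpace Ω] {P : Measure Ω}
    [IsProbabilityMeasure P] {f : Ω → ℝ} {b : ℝ} (hb : ∀ ω, |f ω| ≤ b) : |∫ ω, f ω ∂P| ≤ b := by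
  simpa using norm_integral_le_of_norm_le_const (μ := P) (f := f) (ae_of_all _ hb)

/-- Hoeffding's lemma for a function whose values differ by at most `c`. -/
lemma integral_exp_le_of_abs_sub_le (D : Measure Z) [IsProbabilityMeasure D] {ψ : Z → ℝ}
    (hψ : Measurable ψ) {b c : ℝ} (hb : ∀ z, |ψ z| ≤ b) (hc : ∀ z z', |ψ z - ψ z'| ≤ c) (t : ℝ) :
    ∫ z, Real.exp (t * (ψ z - ∫ z', ψ z' ∂D)) ∂D ≤ Real.exp (c ^ 2 * t ^ 2 / 8) := by
  have : Nonempty Z := nonempty_of_isProbabilityMeasure D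
  have hbdd : BddBelow (Set.range ψ) := ⟨-b, by rintro _ ⟨z, rfl⟩; exact (abs_le.1 (hb z)).1⟩
  -- All values lie in [inf ψ, inf ψ + c], an interval of length exactly c, so Hoeffding's lemma
  -- gives the variance proxy c²/4.
  have h := (hasSubgaussianMGF_of_mem_Icc (μ := D) (X := ψ) (a := ⨅ z, ψ z)
    (b := (⨅ z, ψ z) + c) hψ.aemeasurable (ae_of_all _ fun z => ⟨ciInf_le hbdd z, by
      rw [← sub_le_iff_le_add]
      exact le_ciInf fun z' => by linarith [(abs_le.1 (hc z z')).2]⟩)).mgf_le t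
  refine h.trans_eq ?_
  congr 1
  have : (((‖(⨅ z, ψ z) + c - ⨅ z, ψ z‖₊ / 2) ^ 2 : ℝ≥0) : ℝ) = c ^ 2 / 4 := by
    rw [add_sub_cancel_left]
    push_cast
    rw [Real.norm_eq_abs, div_pow, sq_abs]; norm_num
  rw [this]; ring

/-- The moment generating function bound behind McDiarmid's inequality. -/
theorem integral_exp_le_of_bounded_differences (D : Measure Z) [IsProbabilityMeasure D]
    {b c : ℝ} (t : ℝ) : ∀ {N : ℕ} (φ : (Fin N → Z) → ℝ), Measurable φ → (∀ S, |φ S| ≤ b) →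
    (∀ S n z, |φ (Function.update S n z) - φ S| ≤ c) →
    ∫ S, Real.exp (t * (φ S - ∫ S', φ S' ∂(Measure.pi fun _ => D))) ∂(Measure.pi fun _ => D)
      ≤ Real.exp (N * c ^ 2 * t ^ 2 / 8)
  | 0, φ, _, _, _ => by
      obtain ⟨a, rfl⟩ : ∃ a, φ = fun _ => a :=
        ⟨φ default, funext fun S => by rw [Subsingleton.elim S default]⟩
      simp
  | N + 1, φ, hm, hb, hc => by
      set m := ∫ S', φ S' ∂(Measure.pi fun _ => D) with hmdef
      -- ψ is the conditional mean given the first coordinate. The remaining coordinates are handled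
      -- by induction with the first one frozen, and ψ - m by Hoeffding's lemma.
      set ψ : Z → ℝ := fun z => ∫ S, φ (Fin.cons z S) ∂(Measure.pi fun _ => D) with hψ
      have hcons : Measurable (fun p : Z × (Fin N → Z) => (Fin.cons p.1 p.2 : Fin (N + 1) → Z)) :=
        (measurePreserving_cons D N).measurable
      have hmφ : Measurable (fun p : Z × (Fin N → Z) => φ (Fin.cons p.1 p.2)) := hm.comp hcons
      have hcz : ∀ z, Measurable fun S : Fin N → Z => φ (Fin.cons z S) := fun z =>
        hmφ.comp measurable_prodMk_left
      have hψm : Measurable ψ := hmφ.stronglyMeasurable.integral_prod_right.measurable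
      have hψb : ∀ z, |ψ z| ≤ b := fun z => abs_integral_le_of_abs_le fun S => hb _
      have hmψ : m = ∫ z, ψ z ∂D := integral_pi_succ D (integrable_of_abs_le hm hb)
      have hψc : ∀ z z', |ψ z - ψ z'| ≤ c := by
        intro z z'
        rw [hψ]
        simp only
        rw [← integral_sub (integrable_of_abs_le (hcz z) fun _ => hb _)
          (integrable_of_abs_le (hcz z') fun _ => hb _)]
        refine abs_integral_le_of_abs_le fun S => ?_
        have := hc (Fin.cons z' S) 0 z
        rwa [Fin.update_cons_zero] at this
      have hb0 : 0 ≤ b := (abs_nonneg _).trans (hψb (nonempty_of_isProbabilityMeasure D).some)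
      have hmb : |m| ≤ b := abs_integral_le_of_abs_le hb
      have hexp : ∀ x y : ℝ, |x| ≤ b → |y| ≤ b → |Real.exp (t * (x - y))| ≤
          Real.exp (|t| * (b + b)) := by
        intro x y hx hy
        rw [abs_of_pos (Real.exp_pos _)]
        refine Real.exp_le_exp.2 ((le_abs_self _).trans ?_)
        rw [abs_mul]
        gcongr
        exact (abs_sub _ _).trans (add_le_add hx hy)
      rw [integral_pi_succ D (integrable_of_abs_le (by fun_prop) fun S => hexp _ _ (hb S) hmb)]
      have hin : ∀ z, ∫ S, Real.exp (t * (φ (Fin.cons z S) - m)) ∂(Measure.pi fun _ => D) ≤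
          Real.exp (N * c ^ 2 * t ^ 2 / 8) * Real.exp (t * (ψ z - m)) := by
        intro z
        have ih := integral_exp_le_of_bounded_differences D (b := b) (c := c) t
          (fun S : Fin N → Z => φ (Fin.cons z S)) (hcz z) (fun S => hb _) (fun S n z' => by
            have := hc (Fin.cons z S) n.succ z'
            rwa [← Fin.cons_update] at this)
        calc _ = ∫ S, Real.exp (t * (φ (Fin.cons z S) - ψ z)) * Real.exp (t * (ψ z - m))
              ∂(Measure.pi fun _ => D) := by
                congr 1; ext S; rw [← Real.exp_add]; congr 1; ring
          _ ≤ _ := by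
            rw [integral_mul_const]
            exact mul_le_mul_of_nonneg_right ih (Real.exp_pos _).le
      have hmE : Measurable (fun p : Z × (Fin N → Z) =>
          Real.exp (t * (φ (Fin.cons p.1 p.2) - m))) := by fun_prop
      have hEb : Integrable (fun z => Real.exp (t * (ψ z - m))) D :=
        integrable_of_abs_le (by fun_prop) fun z => hexp _ _ (hψb z) hmb
      calc _ ≤ ∫ z, Real.exp (N * c ^ 2 * t ^ 2 / 8) * Real.exp (t * (ψ z - m)) ∂D := by
            refine integral_mono (integrable_of_abs_le
              hmE.stronglyMeasurable.integral_prod_right.measurable fun z =>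
              abs_integral_le_of_abs_le fun S => hexp _ _ (hb _) hmb) (hEb.const_mul _) hin
        _ ≤ Real.exp (N * c ^ 2 * t ^ 2 / 8) * Real.exp (c ^ 2 * t ^ 2 / 8) := by
            rw [integral_const_mul, hmψ]
            exact mul_le_mul_of_nonneg_left (integral_exp_le_of_abs_sub_le D hψm hψb hψc t)
              (Real.exp_pos _).le
        _ = _ := by rw [← Real.exp_add]; congr 1; push_cast; ring

/-- McDiarmid's inequality, with the deviation expressed through the failure probability. -/
theorem mcdiarmid (D : Measure Z) [IsProbabilityMeasure D] {b c δ : ℝ} (hN : 1 ≤ N)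
    (hc0 : 0 < c) (hδ : 0 < δ) (hδ1 : δ < 1) (φ : (Fin N → Z) → ℝ) (hm : Measurable φ)
    (hb : ∀ S, |φ S| ≤ b) (hc : ∀ S n z, |φ (Function.update S n z) - φ S| ≤ c) :
    (Measure.pi fun _ : Fin N => D) {S | ∫ S', φ S' ∂(Measure.pi fun _ => D) +
      N * c * √(Real.log (1 / δ) / (2 * N)) ≤ φ S} ≤ ENNReal.ofReal δ := by
  set P := Measure.pi fun _ : Fin N => D
  set m := ∫ S', φ S' ∂P
  set ρ := √(Real.log (1 / δ) / (2 * N)) with hρ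
  have hN0 : (0 : ℝ) < N := by exact_mod_cast hN
  have hlog : 0 < Real.log (1 / δ) := Real.log_pos (by rw [lt_div_iff₀ hδ]; linarith)
  have hρ2 : ρ ^ 2 = Real.log (1 / δ) / (2 * N) := Real.sq_sqrt (by positivity)
  have hmb : |m| ≤ b := abs_integral_le_of_abs_le hb
  -- This t minimizes the Chernoff exponent -tNcρ + Nc²t²/8; the minimum is -2Nρ² = log δ.
  set t := 4 * ρ / c with ht
  have ht0 : 0 ≤ t := by positivity
  have hint : Integrable (fun S => Real.exp (t * (φ S - m))) P :=
    integrable_of_abs_le (b := Real.exp (|t| * (b + b))) (by fun_prop) fun S => by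
      rw [abs_of_pos (Real.exp_pos _)]
      refine Real.exp_le_exp.2 ((le_abs_self _).trans ?_)
      rw [abs_mul]
      gcongr
      exact (abs_sub _ _).trans (add_le_add (hb S) hmb)
  have h1 := measure_ge_le_exp_mul_mgf (X := fun S => φ S - m) (N * c * ρ) ht0 hint
  have h2 := integral_exp_le_of_bounded_differences D (b := b) (c := c) t φ hm hb hc
  have h3 : P.real {S | N * c * ρ ≤ φ S - m} ≤ δ := by
    refine h1.trans ?_
    calc _ ≤ Real.exp (-t * (N * c * ρ)) * Real.exp (N * c ^ 2 * t ^ 2 / 8) :=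
          mul_le_mul_of_nonneg_left h2 (Real.exp_pos _).le
      _ = Real.exp (-(2 * N * ρ ^ 2)) := by
          rw [← Real.exp_add]; congr 1; rw [ht]; field_simp; ring
      _ = δ := by
          rw [hρ2, mul_div_cancel₀ _ (by positivity), one_div, Real.log_inv, neg_neg,
            Real.exp_log hδ]
  have h4 : {S | m + N * c * ρ ≤ φ S} = {S | N * c * ρ ≤ φ S - m} := by
    ext S; simp only [Set.mem_ofPred_eq]; constructor <;> intro h <;> linarith
  rw [h4, ← ENNReal.ofReal_toReal (measure_ne_top P _)]
  exact ENNReal.ofReal_le_ofReal h3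

end BoundedDifferences

/-! ### Symmetrization and the Rademacher generalization bound -/

section Symmetrization

lemma ciSup_le_ciSup_add {ι : Type*} [Nonempty ι] {f g : ι → ℝ} {c : ℝ}
    (hg : BddAbove (Set.range g)) (h : ∀ i, f i ≤ g i + c) : ⨆ i, f i ≤ (⨆ i, g i) + c :=
  ciSup_le fun i => (h i).trans (add_le_add_left (le_ciSup hg i) c)

lemma bddAbove_of_abs_le {ι : Type*} {f : ι → ℝ} {b : ℝ} (h : ∀ i, |f i| ≤ b) :
    BddAbove (Set.range f) := ⟨b, by rintro _ ⟨i, rfl⟩; exact (abs_le.1 (h i)).2⟩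

lemma abs_ciSup_le {ι : Type*} [Nonempty ι] {f : ι → ℝ} {b : ℝ} (h : ∀ i, |f i| ≤ b) :
    |⨆ i, f i| ≤ b := by
  refine abs_le.2 ⟨?_, ciSup_le fun i => (abs_le.1 (h i)).2⟩
  exact (abs_le.1 (h (Classical.arbitrary ι))).1.trans
    (le_ciSup (bddAbove_of_abs_le h) (Classical.arbitrary ι))

lemma abs_ciSup_sub_ciSup_le {ι : Type*} [Nonempty ι] {f g : ι → ℝ} {c : ℝ}
    (hf : BddAbove (Set.range f)) (hg : BddAbove (Set.range g)) (h : ∀ i, |f i - g i| ≤ c) :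
    |(⨆ i, f i) - ⨆ i, g i| ≤ c := by
  refine abs_le.2 ⟨?_, ?_⟩
  · have := ciSup_le_ciSup_add (f := g) (c := c) hf fun i => by linarith [(abs_le.1 (h i)).1]
    linarith
  · have := ciSup_le_ciSup_add (f := f) (c := c) hg fun i => by linarith [(abs_le.1 (h i)).2]
    linarith

/-- The sign `±1` encoded by a Boolean. -/
noncomputable def sgn (b : Bool) : ℝ := if b then 1 else -1

lemma abs_sgn (b : Bool) : |sgn b| = 1 := by cases b <;> simp [sgn]

/-- The average over all sign vectors. -/
noncomputable def signAvg {N : ℕ} (T : (Fin N → Bool) → ℝ) : ℝ := (1 / 2 ^ N) * ∑ σ, T σ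

lemma signAvg_const {N : ℕ} (a : ℝ) : signAvg (fun _ : Fin N → Bool => a) = a := by
  simp [signAvg]

lemma signAvg_mono {N : ℕ} {T T' : (Fin N → Bool) → ℝ} (h : ∀ σ, T σ ≤ T' σ) :
    signAvg T ≤ signAvg T' :=
  mul_le_mul_of_nonneg_left (Finset.sum_le_sum fun σ _ => h σ) (by positivity)

lemma signAvg_sub {N : ℕ} (T T' : (Fin N → Bool) → ℝ) :
    signAvg (fun σ => T σ - T' σ) = signAvg T - signAvg T' := by
  simp only [signAvg, Finset.sum_sub_distrib, mul_sub]

lemma signAvg_add {N : ℕ} (T T' : (Fin N → Bool) → ℝ) :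
    signAvg (fun σ => T σ + T' σ) = signAvg T + signAvg T' := by
  simp only [signAvg, Finset.sum_add_distrib, mul_add]

lemma signAvg_sum {N : ℕ} {κ : Type*} (s : Finset κ) (T : κ → (Fin N → Bool) → ℝ) :
    signAvg (fun σ => ∑ q ∈ s, T q σ) = ∑ q ∈ s, signAvg (T q) := by
  simp only [signAvg, Finset.mul_sum]
  exact Finset.sum_comm

lemma signAvg_mul {N : ℕ} (a : ℝ) (T : (Fin N → Bool) → ℝ) :
    signAvg (fun σ => a * T σ) = a * signAvg T := by
  simp only [signAvg, ← Finset.mul_sum]; ring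

lemma signAvg_not {N : ℕ} (T : (Fin N → Bool) → ℝ) :
    signAvg (fun σ => T fun n => !σ n) = signAvg T := by
  simp only [signAvg]
  congr 1
  exact (Equiv.piCongrRight fun _ : Fin N => Equiv.boolNot).sum_comp T

lemma abs_signAvg_le {N : ℕ} {T : (Fin N → Bool) → ℝ} {b : ℝ} (h : ∀ σ, |T σ| ≤ b) :
    |signAvg T| ≤ b := by
  refine abs_le.2 ⟨?_, ?_⟩
  · rw [← signAvg_const (N := N) (-b)]; exact signAvg_mono fun σ => (abs_le.1 (h σ)).1
  · rw [← signAvg_const (N := N) b]; exact signAvg_mono fun σ => (abs_le.1 (h σ)).2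

lemma integral_signAvg {Ω : Type*} [MeasurableSpace Ω] {P : Measure Ω} {N : ℕ}
    {T : Ω → (Fin N → Bool) → ℝ} (h : ∀ σ, Integrable (fun ω => T ω σ) P) :
    ∫ ω, signAvg (T ω) ∂P = signAvg fun σ => ∫ ω, T ω σ ∂P := by
  simp only [signAvg]
  rw [integral_const_mul, integral_finsetSum _ fun σ _ => h σ]

variable {Z : Type*} {N : ℕ} {ι : Type*}

/-- The signed mean of a function over a sample. -/
noncomputable def signedMean (ε : Fin N → ℝ) (h : Z → ℝ) (S : Fin N → Z) : ℝ :=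
  1 / (N : ℝ) * ∑ n, ε n * h (S n)

/-- The empirical Rademacher complexity of a family of functions. -/
noncomputable def rad (h : ι → Z → ℝ) (S : Fin N → Z) : ℝ :=
  signAvg fun σ => ⨆ i, signedMean (fun n => sgn (σ n)) (h i) S

lemma abs_signedMean_le (hN : 1 ≤ N) {M : ℝ} {h : Z → ℝ} (hM : ∀ z, h z ∈ Set.Icc 0 M)
    {ε : Fin N → ℝ} (hε : ∀ n, |ε n| = 1) (S : Fin N → Z) : |signedMean ε h S| ≤ M := by
  have hN0 : (0 : ℝ) < N := by exact_mod_cast hN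
  rw [signedMean, abs_mul, abs_of_pos (by positivity), one_div, inv_mul_le_iff₀ hN0]
  refine (Finset.abs_sum_le_sum_abs _ _).trans ((Finset.sum_le_card_nsmul _ _ M fun n _ => ?_).trans
    (by simp))
  rw [abs_mul, hε, one_mul, abs_of_nonneg (hM _).1]
  exact (hM _).2

lemma abs_signedMean_update_le (hN : 1 ≤ N) {M : ℝ} {h : Z → ℝ} (hM : ∀ z, h z ∈ Set.Icc 0 M)
    {ε : Fin N → ℝ} (hε : ∀ n, |ε n| = 1) (S : Fin N → Z) (n : Fin N) (z : Z) :
    |signedMean ε h (Function.update S n z) - signedMean ε h S| ≤ M / N := by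
  have hN0 : (0 : ℝ) < N := by exact_mod_cast hN
  rw [signedMean, signedMean, ← mul_sub, ← Finset.sum_sub_distrib,
    Finset.sum_eq_single n (fun k _ hk => by rw [Function.update_of_ne hk, sub_self]) (by simp),
    Function.update_self, ← mul_sub, abs_mul, abs_mul, hε, one_mul, abs_of_pos (by positivity),
    one_div, inv_mul_eq_div]
  gcongr
  obtain ⟨h1, h2⟩ := hM z
  obtain ⟨h3, h4⟩ := hM (S n)
  exact abs_le.2 ⟨by linarith, by linarith⟩

variable [MeasurableSpace Z]

/-- Exchangeability of the sample and the ghost sample: in each coordinate the map is the identity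
or the swap of Z × Z, and both preserve D × D. -/
lemma measurePreserving_swapSigns (D : Measure Z) [IsProbabilityMeasure D] (σ : Fin N → Bool) :
    MeasurePreserving (fun p : (Fin N → Z) × (Fin N → Z) =>
      ((fun n => if σ n then p.1 n else p.2 n : Fin N → Z),
        (fun n => if σ n then p.2 n else p.1 n : Fin N → Z)))
      ((Measure.pi fun _ => D).prod (Measure.pi fun _ => D))
      ((Measure.pi fun _ => D).prod (Measure.pi fun _ => D)) := by
  have e := measurePreserving_arrowProdEquivProdArrow Z Z (Fin N) (fun _ => D) (fun _ => D)
  have m : MeasurePreserving (fun (p : Fin N → Z × Z) n => (if σ n then id else Prod.swap) (p n))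
      (Measure.pi fun _ => D.prod D) (Measure.pi fun _ => D.prod D) := by
    refine measurePreserving_pi _ _ fun n => ?_
    cases σ n
    · simpa using Measure.measurePreserving_swap
    · simpa using MeasurePreserving.id _
  convert e.comp (m.comp e.symm) using 1
  ext p : 1
  refine Prod.ext ?_ ?_ <;>
  · ext n
    simp only [Function.comp, MeasurableEquiv.arrowProdEquivProdArrow, Equiv.arrowProdEquivProdArrow]
    cases h : σ n <;> simp [h]

lemma measurable_signedMean {h : Z → ℝ} (hh : Measurable h) (ε : Fin N → ℝ) :
    Measurable (signedMean ε h) := by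
  unfold signedMean; fun_prop

lemma integral_mean (D : Measure Z) [IsProbabilityMeasure D] (hN : 1 ≤ N) {h : Z → ℝ}
    (hh : Integrable h D) :
    ∫ S, signedMean (fun _ : Fin N => 1) h S ∂(Measure.pi fun _ => D) = ∫ z, h z ∂D := by
  have hN0 : (N : ℝ) ≠ 0 := by have : 0 < N := hN; positivity
  have hp := fun n : Fin N => measurePreserving_eval (fun _ : Fin N => D) n
  have h1 : ∀ n : Fin N, ∫ S : Fin N → Z, h (S n) ∂(Measure.pi fun _ => D) = ∫ z, h z ∂D := by
    intro n
    have := (hp n).map_eq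
    rw [← this, integral_map (hp n).aemeasurable (by rw [this]; exact hh.aestronglyMeasurable), this]
  have h2 : ∀ n : Fin N, Integrable (fun S : Fin N → Z => h (S n)) (Measure.pi fun _ => D) :=
    fun n => (hp n).integrable_comp_of_integrable hh
  simp only [signedMean, one_mul]
  rw [integral_const_mul, integral_finsetSum _ fun n _ => h2 n]
  simp only [h1]
  simp [hN0]

/-- Symmetrization. -/
theorem integral_ciSup_sub_mean_le (D : Measure Z) [IsProbabilityMeasure D] (hN : 1 ≤ N)
    [Countable ι] [Nonempty ι] {M : ℝ} {h : ι → Z → ℝ} (hm : ∀ i, Measurable (h i))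
    (hM : ∀ i z, h i z ∈ Set.Icc 0 M) :
    ∫ S : Fin N → Z, (⨆ i, (∫ z, h i z ∂D - signedMean (fun _ => 1) (h i) S))
      ∂(Measure.pi fun _ => D) ≤ 2 * ∫ S : Fin N → Z, rad h S ∂(Measure.pi fun _ => D) := by
  set P := Measure.pi fun _ : Fin N => D
  have habs : ∀ i z, |h i z| ≤ M := fun i z => by
    rw [abs_of_nonneg (hM i z).1]; exact (hM i z).2
  have hint : ∀ i, Integrable (h i) D := fun i => integrable_of_abs_le (hm i) (habs i)
  have hI : ∀ i, |∫ z, h i z ∂D| ≤ M := fun i => abs_integral_le_of_abs_le (habs i)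
  have hmean : ∀ i (S : Fin N → Z), |signedMean (fun _ => 1) (h i) S| ≤ M := fun i S =>
    abs_signedMean_le hN (hM i) (fun _ => abs_one) S
  have hsgn : ∀ (σ : Fin N → Bool) i (S : Fin N → Z),
      |signedMean (fun n => sgn (σ n)) (h i) S| ≤ M := fun σ i S =>
    abs_signedMean_le hN (hM i) (fun _ => abs_sgn _) S
  let W : (Fin N → Z) × (Fin N → Z) → ℝ := fun p =>
    ⨆ i, (signedMean (fun _ => 1) (h i) p.2 - signedMean (fun _ => 1) (h i) p.1)
  have hsub : ∀ {x y : ℝ}, |x| ≤ M → |y| ≤ M → |x - y| ≤ M + M := fun hx hy =>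
    (abs_sub _ _).trans (add_le_add hx hy)
  have hWm : Measurable W := Measurable.iSup fun i =>
    ((measurable_signedMean (hm i) _).comp measurable_snd).sub
      ((measurable_signedMean (hm i) _).comp measurable_fst)
  have hWb : ∀ p, |W p| ≤ M + M := fun p => abs_ciSup_le fun i => hsub (hmean i _) (hmean i _)
  have hWint : Integrable W (P.prod P) := integrable_of_abs_le hWm hWb
  let V : (Fin N → Bool) → (Fin N → Z) → ℝ := fun σ S =>
    ⨆ i, signedMean (fun n => sgn (σ n)) (h i) S
  have hVm : ∀ σ, Measurable (V σ) := fun σ =>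
    Measurable.iSup fun i => measurable_signedMean (hm i) _
  have hVb : ∀ σ S, |V σ S| ≤ M := fun σ S => abs_ciSup_le fun i => hsgn σ i S
  have hVint : ∀ σ, Integrable (V σ) P := fun σ => integrable_of_abs_le (hVm σ) (hVb σ)
  -- The expectation is written as the mean over a ghost sample S'; the supremum of these averages
  -- is at most the average of the suprema.
  have h1 : ∀ S, (⨆ i, (∫ z, h i z ∂D - signedMean (fun _ => 1) (h i) S)) ≤
      ∫ S', W (S, S') ∂P := by
    intro S
    refine ciSup_le fun i => ?_
    rw [← integral_mean D hN (hint i)]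
    have hmi : Integrable (signedMean (fun _ => 1) (h i)) P :=
      integrable_of_abs_le (measurable_signedMean (hm i) _) (hmean i)
    calc _ = ∫ S', (signedMean (fun _ => 1) (h i) S' - signedMean (fun _ => 1) (h i) S) ∂P := by
          rw [integral_sub hmi (integrable_const _)]; simp [P]
      _ ≤ _ := integral_mono (hmi.sub (integrable_const _))
          (integrable_of_abs_le (hWm.comp measurable_prodMk_left) fun S' => hWb _) fun S' =>
          le_ciSup (bddAbove_of_abs_le fun i => hsub (hmean i S') (hmean i S)) i
  -- Exchanging the two samples at the indices where σ is false leaves the integral unchanged and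
  -- inserts signs. The supremum then splits into one part with signs σ and one with signs -σ, whose
  -- averages over σ coincide.
  have h2 : ∀ σ, ∫ p, W p ∂(P.prod P) ≤ ∫ S, V σ S ∂P + ∫ S, V (fun n => !σ n) S ∂P := by
    intro σ
    have mp := measurePreserving_swapSigns D σ
    rw [← mp.map_eq, integral_map mp.aemeasurable
      (by rw [mp.map_eq]; exact hWint.aestronglyMeasurable)]
    have e1 : ∫ S, V σ S ∂P = ∫ p, V σ p.2 ∂(P.prod P) := by
      rw [integral_fun_snd]; simp [P]
    have e2 : ∫ S, V (fun n => !σ n) S ∂P = ∫ p, V (fun n => !σ n) p.1 ∂(P.prod P) := by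
      rw [integral_fun_fst]; simp [P]
    have i1 : Integrable (fun p : (Fin N → Z) × (Fin N → Z) => V σ p.2) (P.prod P) :=
      integrable_of_abs_le ((hVm σ).comp measurable_snd) fun p => hVb _ _
    have i2 : Integrable (fun p : (Fin N → Z) × (Fin N → Z) => V (fun n => !σ n) p.1) (P.prod P) :=
      integrable_of_abs_le ((hVm _).comp measurable_fst) fun p => hVb _ _
    rw [e1, e2, ← integral_add i1 i2]
    refine integral_mono ((mp.integrable_comp_of_integrable hWint)) (i1.add i2) fun p => ?_
    refine ciSup_le fun i => ?_
    have : signedMean (fun _ => 1) (h i) (fun n => if σ n then p.2 n else p.1 n) -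
        signedMean (fun _ => 1) (h i) (fun n => if σ n then p.1 n else p.2 n) =
        signedMean (fun n => sgn (σ n)) (h i) p.2 + signedMean (fun n => sgn (!σ n)) (h i) p.1 := by
      simp only [signedMean, ← mul_sub, ← mul_add, ← Finset.sum_sub_distrib,
        ← Finset.sum_add_distrib]
      congr 1
      refine Finset.sum_congr rfl fun n _ => ?_
      cases hn : σ n <;> simp [sgn] <;> ring
    rw [this]
    exact add_le_add (le_ciSup (bddAbove_of_abs_le fun i => hsgn σ i p.2) i)
      (le_ciSup (bddAbove_of_abs_le fun i => hsgn (fun n => !σ n) i p.1) i)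
  have hDm : Measurable fun S : Fin N → Z =>
      ⨆ i, (∫ z, h i z ∂D - signedMean (fun _ => 1) (h i) S) :=
    Measurable.iSup fun i => measurable_const.sub (measurable_signedMean (hm i) _)
  calc _ ≤ ∫ S, ∫ S', W (S, S') ∂P ∂P :=
        integral_mono (integrable_of_abs_le hDm fun S =>
          abs_ciSup_le fun i => hsub (hI i) (hmean i S)) hWint.integral_prod_left h1
    _ = ∫ p, W p ∂(P.prod P) := (integral_prod _ hWint).symm
    _ = signAvg fun _ : Fin N → Bool => ∫ p, W p ∂(P.prod P) := (signAvg_const _).symm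
    _ ≤ signAvg fun σ => ∫ S, V σ S ∂P + ∫ S, V (fun n => !σ n) S ∂P := signAvg_mono h2
    _ = 2 * signAvg fun σ => ∫ S, V σ S ∂P := by
        rw [signAvg_add, signAvg_not fun σ => ∫ S, V σ S ∂P]; ring
    _ = _ := by rw [← integral_signAvg hVint]; rfl

/-- The generalization bound by the empirical Rademacher complexity, for a countable class. -/
theorem measure_lt_integral_le_of_countable (D : Measure Z) [IsProbabilityMeasure D] (hN : 1 ≤ N)
    [Countable ι] {M δ : ℝ} (hδ : 0 < δ) (hδ1 : δ < 1) {h : ι → Z → ℝ}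
    (hm : ∀ i, Measurable (h i)) (hM : ∀ i z, h i z ∈ Set.Icc 0 M) :
    (Measure.pi fun _ : Fin N => D) {S | ∃ i, signedMean (fun _ => 1) (h i) S + 2 * rad h S +
      3 * M * √(Real.log (1 / δ) / (2 * N)) < ∫ z, h i z ∂D} ≤ ENNReal.ofReal δ := by
  rcases isEmpty_or_nonempty ι with hι | hι
  · simp
  have : Nonempty Z := nonempty_of_isProbabilityMeasure D
  have hM0 : 0 ≤ M := (hM (Classical.arbitrary ι) (Classical.arbitrary Z)).1.trans
    (hM (Classical.arbitrary ι) (Classical.arbitrary Z)).2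
  have hN0 : (0 : ℝ) < N := by exact_mod_cast hN
  -- `mcdiarmid` needs a positive difference bound; for M = 0 all functions vanish.
  rcases hM0.eq_or_lt with rfl | hM0
  · have h0 : ∀ i, h i = 0 := fun i => funext fun z => le_antisymm (hM i z).2 (hM i z).1
    simp [h0, rad, signedMean, signAvg]
  have habs : ∀ i z, |h i z| ≤ M := fun i z => by
    rw [abs_of_nonneg (hM i z).1]; exact (hM i z).2
  have hI : ∀ i, |∫ z, h i z ∂D| ≤ M := fun i => abs_integral_le_of_abs_le (habs i)
  have hmean : ∀ i (S : Fin N → Z), |signedMean (fun _ => 1) (h i) S| ≤ M := fun i S =>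
    abs_signedMean_le hN (hM i) (fun _ => abs_one) S
  have hsgn : ∀ (σ : Fin N → Bool) i (S : Fin N → Z),
      |signedMean (fun n => sgn (σ n)) (h i) S| ≤ M := fun σ i S =>
    abs_signedMean_le hN (hM i) (fun _ => abs_sgn _) S
  have hsub : ∀ {x y : ℝ}, |x| ≤ M → |y| ≤ M → |x - y| ≤ M + M := fun hx hy =>
    (abs_sub _ _).trans (add_le_add hx hy)
  let dev : (Fin N → Z) → ℝ := fun S => ⨆ i, (∫ z, h i z ∂D - signedMean (fun _ => 1) (h i) S)
  have hdb : ∀ S, |dev S| ≤ M + M := fun S => abs_ciSup_le fun i => hsub (hI i) (hmean i S)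
  have hrb : ∀ S : Fin N → Z, |rad h S| ≤ M := fun S =>
    abs_signAvg_le fun σ => abs_ciSup_le fun i => hsgn σ i S
  have hdm : Measurable dev :=
    Measurable.iSup fun i => measurable_const.sub (measurable_signedMean (hm i) _)
  have hrm : Measurable fun S : Fin N → Z => rad h S := by
    unfold rad signAvg
    exact (Finset.measurable_sum _ fun σ _ =>
      Measurable.iSup fun i => measurable_signedMean (hm i) _).const_mul _
  have hφm : Measurable fun S : Fin N → Z => dev S - 2 * rad h S := hdm.sub (hrm.const_mul 2)
  -- A change of one point moves `dev` by M/N and `2 * rad` by 2M/N. Treating the two together costs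
  -- a single failure event of probability δ.
  refine (measure_mono ?_).trans (mcdiarmid D (b := 4 * M) (c := 3 * M / N) hN (by positivity)
    hδ hδ1 (fun S => dev S - 2 * rad h S) hφm (fun S => ?_) fun S n z => ?_)
  · rintro S ⟨i, hi⟩
    have hle : ∫ S : Fin N → Z, (dev S - 2 * rad h S) ∂(Measure.pi fun _ => D) ≤ 0 := by
      rw [integral_sub (integrable_of_abs_le hdm hdb)
        ((integrable_of_abs_le hrm hrb).const_mul 2), integral_const_mul]
      linarith [integral_ciSup_sub_mean_le D hN hm hM]
    have h1 : ∫ z, h i z ∂D - signedMean (fun _ => 1) (h i) S ≤ dev S :=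
      le_ciSup (f := fun i => ∫ z, h i z ∂D - signedMean (fun _ => 1) (h i) S)
        (bddAbove_of_abs_le fun i => hsub (hI i) (hmean i S)) i
    have h2 : (N : ℝ) * (3 * M / N) = 3 * M := by field_simp
    simp only [Set.mem_ofPred_eq]
    rw [h2]
    linarith
  · have h1 := abs_le.1 (hdb S)
    have h2 := abs_le.1 (hrb S)
    exact abs_le.2 ⟨by linarith, by linarith⟩
  · have h1 : |dev (Function.update S n z) - dev S| ≤ M / N :=
      abs_ciSup_sub_ciSup_le (bddAbove_of_abs_le fun i => hsub (hI i) (hmean i _))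
        (bddAbove_of_abs_le fun i => hsub (hI i) (hmean i _)) fun i => by
        rw [sub_sub_sub_cancel_left, abs_sub_comm]
        exact abs_signedMean_update_le hN (hM i) (fun _ => abs_one) S n z
    have h2 : |rad h (Function.update S n z) - rad h S| ≤ M / N := by
      rw [rad, rad, ← signAvg_sub]
      exact abs_signAvg_le fun σ => abs_ciSup_sub_ciSup_le
        (bddAbove_of_abs_le fun i => hsgn σ i _) (bddAbove_of_abs_le fun i => hsgn σ i _) fun i =>
        abs_signedMean_update_le hN (hM i) (fun _ => abs_sgn _) S n z
    have h3 : 3 * M / N = M / N + 2 * (M / N) := by ring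
    rw [h3]
    have h1 := abs_le.1 h1
    have h2 := abs_le.1 h2
    exact abs_le.2 ⟨by linarith, by linarith⟩

/-- The generalization bound by the empirical Rademacher complexity, for a class whose members are
pointwise limits of sequences from a countable subclass. -/
theorem measure_lt_integral_le (D : Measure Z) [IsProbabilityMeasure D] (hN : 1 ≤ N)
    {M δ : ℝ} (hδ : 0 < δ) (hδ1 : δ < 1) {h : ι → Z → ℝ} {s : Set ι} (hs : s.Countable)
    (hm : ∀ i, Measurable (h i)) (hM : ∀ i z, h i z ∈ Set.Icc 0 M)
    (hlim : ∀ i, ∃ g : ℕ → ι, (∀ m, g m ∈ s) ∧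
      ∀ z, Tendsto (fun m => h (g m) z) atTop (𝓝 (h i z))) :
    (Measure.pi fun _ : Fin N => D) {S | ∃ i, signedMean (fun _ => 1) (h i) S + 2 * rad h S +
      3 * M * √(Real.log (1 / δ) / (2 * N)) < ∫ z, h i z ∂D} ≤ ENNReal.ofReal δ := by
  have : Countable s := hs
  refine (measure_mono ?_).trans (measure_lt_integral_le_of_countable D hN hδ hδ1
    (h := fun i : s => h i) (fun i => hm i) fun i => hM i)
  rintro S ⟨i, hi⟩
  obtain ⟨g, hgs, hg⟩ := hlim i
  have : Nonempty s := ⟨⟨g 0, hgs 0⟩⟩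
  -- Passing to the countable subclass only lowers the complexity, so measurability of the supremum
  -- over the full class is never needed.
  have hrad : rad (fun i : s => h i) S ≤ rad h S := signAvg_mono fun σ => ciSup_le fun j =>
    le_ciSup (f := fun i => signedMean (fun n => sgn (σ n)) (h i) S) (bddAbove_of_abs_le fun i =>
      abs_signedMean_le hN (hM i) (fun _ => abs_sgn _) S) (j : ι)
  have h1 : Tendsto (fun m => ∫ z, h (g m) z ∂D) atTop (𝓝 (∫ z, h i z ∂D)) :=
    tendsto_integral_of_dominated_convergence (fun _ => M)
      (fun m => (hm _).aestronglyMeasurable) (integrable_const _)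
      (fun m => ae_of_all _ fun z => by
        rw [Real.norm_eq_abs, abs_of_nonneg (hM _ z).1]; exact (hM _ z).2)
      (ae_of_all _ hg)
  have h2 : Tendsto (fun m => signedMean (fun _ => 1) (h (g m)) S + 2 * rad h S +
      3 * M * √(Real.log (1 / δ) / (2 * N))) atTop (𝓝 (signedMean (fun _ => 1) (h i) S +
      2 * rad h S + 3 * M * √(Real.log (1 / δ) / (2 * N)))) := by
    refine Tendsto.add_const _ (Tendsto.add_const _ ?_)
    exact (tendsto_finsetSum _ fun n _ => (hg (S n)).const_mul 1).const_mul _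
  -- The violated inequality is strict, hence it persists for some approximant in the countable
  -- subclass.
  obtain ⟨m, hmm⟩ := (h2.eventually_lt h1 hi).exists
  exact ⟨⟨g m, hgs m⟩, lt_of_le_of_lt (by linarith) hmm⟩

end Symmetrization

/-! ### Fourth moments and the lower Khintchine inequality -/

section Moments

/-- A centred variable with vanishing third moment, variance `s`, and fourth moment at most that of
a Gaussian of the same variance. -/
structure SubgaussianMoments {Ω : Type*} [MeasurableSpace Ω] (X : Ω → ℝ) (P : Measure Ω) (s : ℝ) :
    Prop where
  memLp : MemLp X 4 P
  first : ∫ ω, X ω ∂P = 0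
  second : ∫ ω, X ω ^ 2 ∂P = s
  third : ∫ ω, X ω ^ 3 ∂P = 0
  fourth : ∫ ω, X ω ^ 4 ∂P ≤ 3 * s ^ 2

lemma integrable_pow_of_memLp_four {Ω : Type*} [MeasurableSpace Ω] {X : Ω → ℝ} {P : Measure Ω}
    [IsFiniteMeasure P] (h : MemLp X 4 P) {k : ℕ} (hk : k ≤ 4) :
    Integrable (fun ω => X ω ^ k) P := by
  have h1 : MemLp X (k : ℝ≥0∞) P := h.mono_exponent (by exact_mod_cast hk)
  have h2 := h1.integrable_norm_pow'
  refine h2.mono (h.aestronglyMeasurable.pow k) (ae_of_all _ fun ω => ?_)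
  simp

variable {Ω Ω' : Type*} [MeasurableSpace Ω] [MeasurableSpace Ω'] {X : Ω → ℝ} {Y : Ω' → ℝ}
  {P : Measure Ω} {P' : Measure Ω'} {s s' : ℝ}

lemma SubgaussianMoments.const_mul (h : SubgaussianMoments X P s) (a : ℝ) :
    SubgaussianMoments (fun ω => a * X ω) P (a ^ 2 * s) where
  memLp := h.memLp.const_mul a
  first := by rw [integral_const_mul, h.first, mul_zero]
  second := by simp only [mul_pow]; rw [integral_const_mul, h.second]
  third := by simp only [mul_pow]; rw [integral_const_mul, h.third, mul_zero]
  fourth := by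
    simp only [mul_pow]; rw [integral_const_mul]
    nlinarith [mul_le_mul_of_nonneg_left h.fourth (by positivity : 0 ≤ a ^ 4)]

/-- In the fourth moment of an independent sum the odd cross terms vanish, and 6ss' is exactly the
cross term of 3(s + s')²; this is why the Gaussian constant 3 is stable under sums. -/
lemma SubgaussianMoments.add_prod [IsProbabilityMeasure P] [IsProbabilityMeasure P']
    (h : SubgaussianMoments X P s) (h' : SubgaussianMoments Y P' s') :
    SubgaussianMoments (fun p : Ω × Ω' => X p.1 + Y p.2) (P.prod P') (s + s') := by
  have hX := fun k hk => integrable_pow_of_memLp_four h.memLp (k := k) hk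
  have hY := fun k hk => integrable_pow_of_memLp_four h'.memLp (k := k) hk
  have hint : ∀ (c : ℝ) (k l : ℕ), k ≤ 4 → l ≤ 4 →
      Integrable (fun p : Ω × Ω' => c * (X p.1 ^ k * Y p.2 ^ l)) (P.prod P') := fun c k l hk hl =>
    ((hX k hk).mul_prod (hY l hl)).const_mul c
  have hval : ∀ (c : ℝ) (k l : ℕ), ∫ p : Ω × Ω', c * (X p.1 ^ k * Y p.2 ^ l) ∂(P.prod P') =
      c * ((∫ ω, X ω ^ k ∂P) * ∫ ω, Y ω ^ l ∂P') := fun c k l => by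
    rw [integral_const_mul, integral_prod_mul (fun x => X x ^ k) (fun y => Y y ^ l)]
  have x0 : ∫ ω, X ω ^ 0 ∂P = 1 := by simp
  have y0 : ∫ ω, Y ω ^ 0 ∂P' = 1 := by simp
  have x1 : ∫ ω, X ω ^ 1 ∂P = 0 := by simpa using h.first
  have y1 : ∫ ω, Y ω ^ 1 ∂P' = 0 := by simpa using h'.first
  refine ⟨(h.memLp.comp_fst P').add (h'.memLp.comp_snd P), ?_, ?_, ?_, ?_⟩
  · have e : ∀ p : Ω × Ω', X p.1 + Y p.2 =
        1 * (X p.1 ^ 1 * Y p.2 ^ 0) + 1 * (X p.1 ^ 0 * Y p.2 ^ 1) := fun p => by ring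
    simp only [e]
    rw [integral_add (hint _ _ _ (by norm_num) (by norm_num))
      (hint _ _ _ (by norm_num) (by norm_num)), hval, hval, x1, y1]
    ring
  · have e : ∀ p : Ω × Ω', (X p.1 + Y p.2) ^ 2 = 1 * (X p.1 ^ 2 * Y p.2 ^ 0) +
        2 * (X p.1 ^ 1 * Y p.2 ^ 1) + 1 * (X p.1 ^ 0 * Y p.2 ^ 2) := fun p => by ring
    simp only [e]
    have i1 := hint 1 2 0 (by norm_num) (by norm_num)
    have i2 := hint 2 1 1 (by norm_num) (by norm_num)
    have i3 := hint 1 0 2 (by norm_num) (by norm_num)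
    rw [integral_add (i1.fun_add i2) i3, integral_add i1 i2, hval, hval, hval, x1, y1, x0, y0,
      h.second, h'.second]
    ring
  · have e : ∀ p : Ω × Ω', (X p.1 + Y p.2) ^ 3 = 1 * (X p.1 ^ 3 * Y p.2 ^ 0) +
        3 * (X p.1 ^ 2 * Y p.2 ^ 1) + 3 * (X p.1 ^ 1 * Y p.2 ^ 2) +
        1 * (X p.1 ^ 0 * Y p.2 ^ 3) := fun p => by ring
    simp only [e]
    have i1 := hint 1 3 0 (by norm_num) (by norm_num)
    have i2 := hint 3 2 1 (by norm_num) (by norm_num)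
    have i3 := hint 3 1 2 (by norm_num) (by norm_num)
    have i4 := hint 1 0 3 (by norm_num) (by norm_num)
    rw [integral_add ((i1.fun_add i2).fun_add i3) i4, integral_add (i1.fun_add i2) i3, integral_add i1 i2,
      hval, hval, hval, hval, x1, y1, h.third, h'.third]
    ring
  · have e : ∀ p : Ω × Ω', (X p.1 + Y p.2) ^ 4 = 1 * (X p.1 ^ 4 * Y p.2 ^ 0) +
        4 * (X p.1 ^ 3 * Y p.2 ^ 1) + 6 * (X p.1 ^ 2 * Y p.2 ^ 2) +
        4 * (X p.1 ^ 1 * Y p.2 ^ 3) + 1 * (X p.1 ^ 0 * Y p.2 ^ 4) := fun p => by ring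
    simp only [e]
    have i1 := hint 1 4 0 (by norm_num) (by norm_num)
    have i2 := hint 4 3 1 (by norm_num) (by norm_num)
    have i3 := hint 6 2 2 (by norm_num) (by norm_num)
    have i4 := hint 4 1 3 (by norm_num) (by norm_num)
    have i5 := hint 1 0 4 (by norm_num) (by norm_num)
    rw [integral_add (((i1.fun_add i2).fun_add i3).fun_add i4) i5, integral_add ((i1.fun_add i2).fun_add i3) i4,
      integral_add (i1.fun_add i2) i3, integral_add i1 i2,
      hval, hval, hval, hval, hval, x1, y1, x0, y0, h.third, h'.third, h.second, h'.second]
    nlinarith [h.fourth, h'.fourth]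

lemma SubgaussianMoments.comp (h : SubgaussianMoments X P s) {g : Ω' → Ω}
    (hg : MeasurePreserving g P' P) : SubgaussianMoments (fun ω => X (g ω)) P' s := by
  have e : ∀ k, ∫ ω, X (g ω) ^ k ∂P' = ∫ ω, X ω ^ k ∂P := fun k => by
    rw [← hg.map_eq, integral_map hg.aemeasurable]
    rw [hg.map_eq]; exact h.memLp.aestronglyMeasurable.pow k
  refine ⟨h.memLp.comp_measurePreserving hg, ?_, ?_, ?_, ?_⟩
  · have := e 1
    simp only [pow_one] at this
    rw [this, h.first]
  · rw [e, h.second]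
  · rw [e, h.third]
  · rw [e]; exact h.fourth

lemma SubgaussianMoments.sum_pi {ν : Measure ℝ} [IsProbabilityMeasure ν]
    (h : SubgaussianMoments (fun x => x) ν 1) : ∀ {C : ℕ} (a : Fin C → ℝ),
    SubgaussianMoments (fun ξ : Fin C → ℝ => ∑ j, ξ j * a j) (Measure.pi fun _ => ν)
      (∑ j, a j ^ 2)
  | 0, a => by constructor <;> simp
  | C + 1, a => by
      have h1 := (h.const_mul (a 0)).add_prod (SubgaussianMoments.sum_pi h fun j : Fin C => a j.succ)
      have h2 := h1.comp (measurePreserving_piFinSuccAbove (fun _ : Fin (C + 1) => ν) 0)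
      convert h2 using 1
      · ext ξ
        rw [Fin.sum_univ_succ, mul_comm (ξ 0)]
        rfl
      · rw [Fin.sum_univ_succ, mul_one]

/-- The lower Khintchine inequality from the second and fourth moments. -/
lemma SubgaussianMoments.sqrt_le_integral_abs [IsProbabilityMeasure P]
    (h : SubgaussianMoments X P s) : 9 / 16 * √s ≤ ∫ ω, |X ω| ∂P := by
  have hs : 0 ≤ s := by rw [← h.second]; exact integral_nonneg fun ω => sq_nonneg _
  rcases hs.eq_or_lt with rfl | hs
  · simpa using integral_nonneg fun ω => abs_nonneg (X ω)
  set r := √s with hr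
  have hr0 : 0 < r := Real.sqrt_pos.2 hs
  have hr2 : s = r ^ 2 := (Real.sq_sqrt hs.le).symm
  have i2 := integrable_pow_of_memLp_four h.memLp (k := 2) (by norm_num)
  have i4 := integrable_pow_of_memLp_four h.memLp (k := 4) (by norm_num)
  have i1 : Integrable (fun ω => |X ω|) P := by
    simpa using (integrable_pow_of_memLp_four h.memLp (k := 1) (by norm_num)).abs
  -- The quartic minorant of |x| touches it at |x| = 2r, and the difference factors as below.
  -- Integration gives (3/4 - 3/16)r = (9/16)r.
  have key : ∀ x : ℝ, 3 / (4 * r) * x ^ 2 - 1 / (16 * r ^ 3) * x ^ 4 ≤ |x| := by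
    intro x
    rw [← sq_abs x, ← Even.pow_abs (by decide : Even 4) x]
    set t := |x|
    have ht : 0 ≤ t := abs_nonneg x
    have : t - (3 / (4 * r) * t ^ 2 - 1 / (16 * r ^ 3) * t ^ 4) =
        t * (t - 2 * r) ^ 2 * (t + 4 * r) / (16 * r ^ 3) := by
      field_simp; ring
    have h2 : 0 ≤ t * (t - 2 * r) ^ 2 * (t + 4 * r) / (16 * r ^ 3) := by positivity
    linarith
  calc 9 / 16 * r = 3 / (4 * r) * s - 1 / (16 * r ^ 3) * (3 * s ^ 2) := by
        rw [hr2]; field_simp; ring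
    _ ≤ 3 / (4 * r) * ∫ ω, X ω ^ 2 ∂P - 1 / (16 * r ^ 3) * ∫ ω, X ω ^ 4 ∂P := by
        rw [h.second]
        gcongr
        exact h.fourth
    _ = ∫ ω, (3 / (4 * r) * X ω ^ 2 - 1 / (16 * r ^ 3) * X ω ^ 4) ∂P := by
        rw [integral_sub (i2.const_mul _) (i4.const_mul _), integral_const_mul, integral_const_mul]
    _ ≤ _ := integral_mono ((i2.const_mul _).sub (i4.const_mul _)) i1 fun ω => key _

instance : IsProbabilityMeasure rademacher where
  measure_univ := by
    rw [rademacher]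
    simp only [Measure.smul_apply, Measure.add_apply, measure_univ, smul_eq_mul]
    rw [one_add_one_eq_two, mul_comm]
    exact ENNReal.mul_inv_cancel two_ne_zero ENNReal.ofNat_ne_top

lemma integral_rademacher (f : ℝ → ℝ) : ∫ x, f x ∂rademacher = (f 1 + f (-1)) / 2 := by
  rw [rademacher, integral_smul_measure, integral_add_measure (integrable_dirac (by simp))
    (integrable_dirac (by simp)), integral_dirac, integral_dirac]
  simp; ring

lemma subgaussianMoments_rademacher : SubgaussianMoments (fun x => x) rademacher 1 where
  memLp := by
    refine MemLp.of_bound (by fun_prop) 1 ?_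
    rw [rademacher]
    refine Measure.ae_smul_measure (ae_add_measure_iff.2 ⟨?_, ?_⟩) _ <;> simp [ae_dirac_eq]
  first := by rw [integral_rademacher]; norm_num
  second := by rw [integral_rademacher fun x => x ^ 2]; norm_num
  third := by rw [integral_rademacher fun x => x ^ 3]; norm_num
  fourth := by rw [integral_rademacher fun x => x ^ 4]; norm_num

lemma rademacher_map_neg : rademacher.map (fun x => -x) = rademacher := by
  rw [rademacher, Measure.map_smul, Measure.map_add _ _ measurable_neg, Measure.map_dirac',
    Measure.map_dirac', neg_neg, add_comm] <;> exact measurable_neg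

lemma integral_pow_gaussianReal (k : ℕ) :
    ∫ x, x ^ k ∂(gaussianReal 0 1) = iteratedDeriv k (fun t => Real.exp (t ^ 2 / 2)) 0 := by
  have h := iteratedDeriv_mgf_zero (X := fun x : ℝ => x) (μ := gaussianReal 0 1) (by
    rw [integrableExpSet_fun_id_gaussianReal]; simp) k
  rw [mgf_fun_id_gaussianReal] at h
  simp only [Pi.pow_apply] at h
  rw [← h]
  simp

lemma subgaussianMoments_gaussianReal :
    SubgaussianMoments (fun x => x) (gaussianReal 0 1) 1 := by
  have d0 : ∀ t : ℝ, HasDerivAt (fun t : ℝ => Real.exp (t ^ 2 / 2)) (t * Real.exp (t ^ 2 / 2)) t :=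
    fun t => by
      have := (((hasDerivAt_id' t).fun_pow 2).div_const 2).exp
      convert this using 1
      push_cast; ring
  -- Differentiating p(t)exp(t²/2) replaces p by p' + tp. Iterating from p = 1 and evaluating at 0
  -- produces the Gaussian moments.
  have dp : ∀ (p p' : ℝ → ℝ), (∀ t, HasDerivAt p (p' t) t) → deriv (fun t : ℝ => p t *
      Real.exp (t ^ 2 / 2)) = fun t => (p' t + t * p t) * Real.exp (t ^ 2 / 2) := by
    intro p p' hp
    ext t
    rw [((hp t).fun_mul (d0 t)).deriv]; ring
  have e1 : deriv (fun t : ℝ => Real.exp (t ^ 2 / 2)) = fun t => t * Real.exp (t ^ 2 / 2) :=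
    funext fun t => (d0 t).deriv
  have e2 := dp (fun t => t) (fun _ => 1) fun t => hasDerivAt_id t
  have e3 := dp (fun t => 1 + t * t) (fun t => 2 * t) fun t => by
    exact (((hasDerivAt_id' t).fun_mul (hasDerivAt_id' t)).const_add 1).congr_deriv (by ring)
  have e4 := dp (fun t => 2 * t + t * (1 + t * t)) (fun t => 3 + 3 * t ^ 2) fun t => by
    exact (((hasDerivAt_id' t).const_mul 2).fun_add ((hasDerivAt_id' t).fun_mul
      (((hasDerivAt_id' t).fun_mul (hasDerivAt_id' t)).const_add 1))).congr_deriv (by ring)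
  refine ⟨memLp_id_gaussianReal 4, ?_, ?_, ?_, ?_⟩
  · simp
  · rw [integral_pow_gaussianReal 2]
    simp only [iteratedDeriv_succ', iteratedDeriv_zero, e1, e2]
    simp
  · rw [integral_pow_gaussianReal 3]
    simp only [iteratedDeriv_succ', iteratedDeriv_zero, e1, e2, e3]
    simp
  · rw [integral_pow_gaussianReal 4]
    simp only [iteratedDeriv_succ', iteratedDeriv_zero, e1, e2, e3, e4]
    simp

end Moments

/-! ### Vector contraction -/

section Contraction

variable {ι : Type*}

/-- A bounded real function. -/
def Bounded (f : ι → ℝ) : Prop := ∃ b, ∀ i, |f i| ≤ b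

namespace Bounded

lemma bddAbove {f : ι → ℝ} (hf : Bounded f) : BddAbove (Set.range f) :=
  hf.elim fun _ h => bddAbove_of_abs_le h

lemma zero : Bounded fun _ : ι => (0 : ℝ) := ⟨0, by simp⟩

lemma add {f g : ι → ℝ} (hf : Bounded f) (hg : Bounded g) : Bounded fun i => f i + g i := by
  obtain ⟨b, hb⟩ := hf
  obtain ⟨c, hc⟩ := hg
  exact ⟨b + c, fun i => (abs_add_le _ _).trans (add_le_add (hb i) (hc i))⟩

lemma const_mul {f : ι → ℝ} (hf : Bounded f) (c : ℝ) : Bounded fun i => c * f i := by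
  obtain ⟨b, hb⟩ := hf
  exact ⟨|c| * b, fun i => by rw [abs_mul]; exact mul_le_mul_of_nonneg_left (hb i) (abs_nonneg c)⟩

lemma sum {κ : Type*} {s : Finset κ} {f : κ → ι → ℝ} (hf : ∀ k ∈ s, Bounded (f k)) :
    Bounded fun i => ∑ k ∈ s, f k i := by
  classical
  induction s using Finset.induction_on with
  | empty => simpa using zero
  | insert a s ha ih =>
    simp only [Finset.sum_insert ha]
    exact (hf a (Finset.mem_insert_self a s)).add
      (ih fun k hk => hf k (Finset.mem_insert_of_mem hk))

end Bounded

/-- As a function of the noise the supremum is Lipschitz, because the coefficients are uniformly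
bounded. This gives measurability for an uncountable index set, and domination by the value at zero
plus Σ |x_k| b_k. -/
lemma measurable_integrable_ciSup_linear {Ω : Type*} [MeasurableSpace Ω] {P : Measure Ω}
    [IsFiniteMeasure P] [Nonempty ι] {κ : Type*} [Fintype κ] {x : Ω → κ → ℝ}
    (hxm : ∀ k, Measurable fun ω => x ω k) (hx : ∀ k, Integrable (fun ω => x ω k) P) {G : ι → ℝ}
    (hG : Bounded G) {a : κ → ι → ℝ} (ha : ∀ k, Bounded (a k)) :
    Measurable (fun ω => ⨆ i, (G i + ∑ k, x ω k * a k i)) ∧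
      Integrable (fun ω => ⨆ i, (G i + ∑ k, x ω k * a k i)) P := by
  choose b hb using ha
  have hbdd : ∀ y : κ → ℝ, BddAbove (Set.range fun i => G i + ∑ k, y k * a k i) := fun y =>
    (hG.add (Bounded.sum fun k _ => Bounded.const_mul ⟨b k, hb k⟩ (y k))).bddAbove
  have hlip : ∀ y y' : κ → ℝ, |(⨆ i, (G i + ∑ k, y k * a k i)) - ⨆ i, (G i + ∑ k, y' k * a k i)|
      ≤ ∑ k, |y k - y' k| * b k := fun y y' =>
    abs_ciSup_sub_ciSup_le (hbdd y) (hbdd y') fun i => by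
      rw [add_sub_add_left_eq_sub, ← Finset.sum_sub_distrib]
      refine (Finset.abs_sum_le_sum_abs _ _).trans (Finset.sum_le_sum fun k _ => ?_)
      rw [← sub_mul, abs_mul]
      exact mul_le_mul_of_nonneg_left (hb k i) (abs_nonneg _)
  have hcont : Continuous fun y : κ → ℝ => ⨆ i, (G i + ∑ k, y k * a k i) := by
    rw [continuous_iff_continuousAt]
    intro y
    rw [ContinuousAt, tendsto_iff_norm_sub_tendsto_zero]
    refine squeeze_zero (fun _ => norm_nonneg _) (fun y' => hlip y' y) ?_
    have : Continuous fun y' : κ → ℝ => ∑ k, |y' k - y k| * b k := by fun_prop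
    simpa using this.tendsto y
  have hm : Measurable fun ω => ⨆ i, (G i + ∑ k, x ω k * a k i) :=
    hcont.measurable.comp (measurable_pi_iff.2 hxm)
  refine ⟨hm, ?_⟩
  have hdom : Integrable (fun ω => |⨆ i, (G i + ∑ k, (0 : κ → ℝ) k * a k i)| +
      ∑ k, |x ω k| * b k) P :=
    (integrable_const _).add (integrable_finsetSum _ fun k _ => (hx k).abs.mul_const _)
  refine hdom.mono' hm.aestronglyMeasurable (ae_of_all _ fun ω => ?_)
  have h1 := hlip (x ω) 0
  simp only [Pi.zero_apply, sub_zero] at h1 ⊢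
  rw [Real.norm_eq_abs]
  have h2 := abs_sub_abs_le_abs_sub (⨆ i, (G i + ∑ k, x ω k * a k i))
    (⨆ i, (G i + ∑ k, (0 : ℝ) * a k i))
  linarith

/-- The laws for which the contraction inequality below is proved. -/
structure ContractionLaw (ν : Measure ℝ) : Prop where
  isProbabilityMeasure : IsProbabilityMeasure ν
  map_neg : ν.map (fun x => -x) = ν
  moments : SubgaussianMoments (fun x => x) ν 1

lemma contractionLaw_of_eq {ν : Measure ℝ} (h : ν = rademacher ∨ ν = gaussianReal 0 1) :
    ContractionLaw ν := by
  rcases h with rfl | rfl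
  · exact ⟨inferInstance, rademacher_map_neg, subgaussianMoments_rademacher⟩
  · exact ⟨inferInstance, by rw [gaussianReal_map_neg, neg_zero], subgaussianMoments_gaussianReal⟩

variable {ν : Measure ℝ} {C N : ℕ}

lemma ContractionLaw.integrable_coord (hν : ContractionLaw ν) (j : Fin C) :
    Integrable (fun ξ : Fin C → ℝ => ξ j) (Measure.pi fun _ => ν) := by
  have := hν.isProbabilityMeasure
  have h := integrable_pow_of_memLp_four hν.moments.memLp (k := 1) (by norm_num)
  simp only [pow_one] at h
  exact (measurePreserving_eval (fun _ : Fin C => ν) j).integrable_comp_of_integrable h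

lemma ContractionLaw.integrable_coord_coord (hν : ContractionLaw ν) (n : Fin N) (j : Fin C) :
    Integrable (fun ξ : Fin N → Fin C → ℝ => ξ n j)
      (Measure.pi fun _ => Measure.pi fun _ => ν) := by
  have := hν.isProbabilityMeasure
  exact (measurePreserving_eval (fun _ : Fin N => Measure.pi fun _ : Fin C => ν)
    n).integrable_comp_of_integrable (hν.integrable_coord j)

lemma ContractionLaw.integrable_ciSup (hν : ContractionLaw ν) [Nonempty ι] {G : ι → ℝ}
    (hG : Bounded G) {a : Fin C → ι → ℝ} (ha : ∀ j, Bounded (a j)) (c : ℝ) :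
    Integrable (fun ξ : Fin C → ℝ => ⨆ i, (G i + c * ∑ j, ξ j * a j i))
      (Measure.pi fun _ => ν) := by
  have := hν.isProbabilityMeasure
  have h := (measurable_integrable_ciSup_linear (P := Measure.pi fun _ : Fin C => ν) (κ := Fin C)
    (x := fun ξ => ξ) (fun j => measurable_pi_apply j) hν.integrable_coord hG
    (a := fun j i => c * a j i) fun j => (ha j).const_mul c).2
  convert h using 5
  rw [Finset.mul_sum]
  exact Finset.sum_congr rfl fun j _ => by ring

lemma ContractionLaw.integrable_ciSup₂ (hν : ContractionLaw ν) [Nonempty ι] {G : ι → ℝ}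
    (hG : Bounded G) {a : Fin N → Fin C → ι → ℝ} (ha : ∀ n j, Bounded (a n j)) (c : ℝ) :
    Integrable (fun ξ : Fin N → Fin C → ℝ => ⨆ i, (G i + c * ∑ n, ∑ j, ξ n j * a n j i))
      (Measure.pi fun _ => Measure.pi fun _ => ν) := by
  have := hν.isProbabilityMeasure
  have h := (measurable_integrable_ciSup_linear
    (P := Measure.pi fun _ : Fin N => Measure.pi fun _ : Fin C => ν) (κ := Fin N × Fin C)
    (x := fun ξ k => ξ k.1 k.2)
    (fun k => (measurable_pi_apply k.2).comp (measurable_pi_apply k.1))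
    (fun k => hν.integrable_coord_coord k.1 k.2) hG
    (a := fun k i => c * a k.1 k.2 i) fun k => (ha k.1 k.2).const_mul c).2
  convert h using 5
  rw [Fintype.sum_prod_type, Finset.mul_sum]
  refine Finset.sum_congr rfl fun n _ => ?_
  rw [Finset.mul_sum]
  exact Finset.sum_congr rfl fun j _ => by ring

/-- The contraction inequality for a single random sign. -/
lemma ContractionLaw.contraction_step (hν : ContractionLaw ν) [Nonempty ι] {G ψ : ι → ℝ}
    {a : Fin C → ι → ℝ} (hG : Bounded G) (ha : ∀ j, Bounded (a j))
    (hψ : ∀ i k, |ψ i - ψ k| ≤ √(∑ j, (a j i - a j k) ^ 2)) :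
    1 / 2 * ((⨆ i, (G i + ψ i)) + ⨆ i, (G i + -ψ i)) ≤
      ∫ ξ : Fin C → ℝ, (⨆ i, (G i + 2 * ∑ j, ξ j * a j i)) ∂(Measure.pi fun _ => ν) := by
  have := hν.isProbabilityMeasure
  set P := Measure.pi fun _ : Fin C => ν
  let Φ : (Fin C → ℝ) → ℝ := fun ξ => ⨆ i, (G i + 2 * ∑ j, ξ j * a j i)
  have hint : Integrable Φ P := hν.integrable_ciSup hG ha 2
  have hneg : MeasurePreserving (fun ξ : Fin C → ℝ => fun j => -ξ j) P P :=
    measurePreserving_pi _ _ fun _ => ⟨measurable_neg, hν.map_neg⟩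
  have hnint : Integrable (fun ξ => Φ fun j => -ξ j) P := hneg.integrable_comp_of_integrable hint
  have hsym : ∫ ξ, Φ (fun j => -ξ j) ∂P = ∫ ξ, Φ ξ ∂P := by
    conv_rhs => rw [← hneg.map_eq]
    rw [integral_map hneg.aemeasurable]
    rw [hneg.map_eq]; exact hint.aestronglyMeasurable
  have hle : ∀ ξ i, G i + 2 * ∑ j, ξ j * a j i ≤ Φ ξ := fun ξ i =>
    le_ciSup (f := fun i => G i + 2 * ∑ j, ξ j * a j i) (hG.add ((Bounded.sum fun j _ =>
      (ha j).const_mul (ξ j)).const_mul 2)).bddAbove i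
  -- The two suprema are attacked through pairs i, k. The Lipschitz bound and Khintchine give ψ_i -
  -- ψ_k ≤ (16/9) E|⟨ξ, a_i - a_k⟩|, and 16/9 ≤ 2. The absolute value is then absorbed by choosing
  -- which of i, k is tested at ξ and which at -ξ.
  have key : ∀ i k, G i + ψ i + (G k + -ψ k) ≤ 2 * ∫ ξ, Φ ξ ∂P := by
    intro i k
    have hm := SubgaussianMoments.sum_pi hν.moments fun j => a j i - a j k
    have h1 := hm.sqrt_le_integral_abs
    have h2 := (abs_le.1 (hψ i k)).2
    have h0 := Real.sqrt_nonneg (∑ j, (a j i - a j k) ^ 2)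
    have hia : Integrable (fun ξ : Fin C → ℝ => |∑ j, ξ j * (a j i - a j k)|) P := by
      simpa using (integrable_pow_of_memLp_four hm.memLp (k := 1) (by norm_num)).abs
    calc G i + ψ i + (G k + -ψ k) ≤
          G i + G k + 2 * ∫ ξ : Fin C → ℝ, |∑ j, ξ j * (a j i - a j k)| ∂P := by linarith
      _ = ∫ ξ : Fin C → ℝ, (G i + G k + 2 * |∑ j, ξ j * (a j i - a j k)|) ∂P := by
          rw [integral_add (integrable_const _) (hia.const_mul 2), integral_const_mul]
          simp [P]
      _ ≤ ∫ ξ, (Φ ξ + Φ fun j => -ξ j) ∂P := by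
          refine integral_mono ((integrable_const _).add (hia.const_mul 2)) (hint.add hnint)
            fun ξ => ?_
          have e : ∑ j, ξ j * (a j i - a j k) = ∑ j, ξ j * a j i - ∑ j, ξ j * a j k := by
            rw [← Finset.sum_sub_distrib]; exact Finset.sum_congr rfl fun j _ => by ring
          have en : ∀ l, ∑ j, -ξ j * a j l = -∑ j, ξ j * a j l := fun l => by
            rw [← Finset.sum_neg_distrib]; exact Finset.sum_congr rfl fun j _ => by ring
          have u1 := hle ξ i
          have u2 := hle ξ k
          have u3 := hle (fun j => -ξ j) i
          have u4 := hle (fun j => -ξ j) k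
          rw [en] at u3 u4
          simp only [e]
          rcases abs_cases (∑ j, ξ j * a j i - ∑ j, ξ j * a j k) with ⟨h, _⟩ | ⟨h, _⟩ <;>
            rw [h] <;> linarith
      _ = 2 * ∫ ξ, Φ ξ ∂P := by rw [integral_add hint hnint, hsym]; ring
  have h3 : (⨆ i, (G i + ψ i)) ≤ 2 * ∫ ξ, Φ ξ ∂P - ⨆ i, (G i + -ψ i) := by
    refine ciSup_le fun i => ?_
    have : (⨆ k, (G k + -ψ k)) ≤ 2 * ∫ ξ, Φ ξ ∂P - (G i + ψ i) :=
      ciSup_le fun k => by linarith [key i k]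
    linarith
  linarith

lemma signAvg_succ (T : (Fin (N + 1) → Bool) → ℝ) :
    signAvg T = 1 / 2 * (signAvg (fun σ : Fin N → Bool => T (Fin.cons true σ)) +
      signAvg fun σ : Fin N → Bool => T (Fin.cons false σ)) := by
  simp only [signAvg]
  rw [← (Fin.consEquiv fun _ : Fin (N + 1) => Bool).sum_comp T, Fintype.sum_prod_type,
    Fintype.sum_bool]
  change _ * (∑ σ, T (Fin.cons true σ) + ∑ σ, T (Fin.cons false σ)) = _
  rw [pow_succ]
  field_simp

lemma integral_pi_succ_symm {Z : Type*} [MeasurableSpace Z] (D : Measure Z) [SigmaFinite D]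
    {F : (Fin (N + 1) → Z) → ℝ} (hF : Integrable F (Measure.pi fun _ => D)) :
    ∫ S, F S ∂(Measure.pi fun _ => D) =
      ∫ S, ∫ z, F (Fin.cons z S) ∂D ∂(Measure.pi fun _ => D) := by
  have h := (measurePreserving_cons D N).integrable_comp_of_integrable hF
  rw [integral_pi_succ D hF, integral_integral_swap (f := fun z S => F (Fin.cons z S)) h]

/-- The vector contraction inequality. -/
theorem ContractionLaw.contraction (hν : ContractionLaw ν) [Nonempty ι] : ∀ {N : ℕ} {G : ι → ℝ}
    {ψ : Fin N → ι → ℝ} {a : Fin N → Fin C → ι → ℝ}, Bounded G → (∀ n, Bounded (ψ n)) →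
    (∀ n j, Bounded (a n j)) →
    (∀ n i k, |ψ n i - ψ n k| ≤ √(∑ j, (a n j i - a n j k) ^ 2)) →
    signAvg (fun σ : Fin N → Bool => ⨆ i, (G i + ∑ n, sgn (σ n) * ψ n i)) ≤
      ∫ ξ : Fin N → Fin C → ℝ, (⨆ i, (G i + 2 * ∑ n, ∑ j, ξ n j * a n j i))
        ∂(Measure.pi fun _ => Measure.pi fun _ => ν)
  | 0, G, ψ, a, _, _, _, _ => by
      have := hν.isProbabilityMeasure
      simp [signAvg]
  | N + 1, G, ψ, a, hG, hψ, ha, hl => by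
      have := hν.isProbabilityMeasure
      have hi := hν.integrable_ciSup₂ hG ha 2
      have hp : Bounded fun i => G i + ψ 0 i := hG.add (hψ 0)
      have hm : Bounded fun i => G i + -ψ 0 i := by
        simpa using hG.add ((hψ 0).const_mul (-1))
      -- The first sign is absorbed into the offset as ±ψ 0, and the other signs are contracted by
      -- induction. With their noise ξ then fixed, `contraction_step` removes the first sign.
      have ihp := hν.contraction hp (fun n => hψ n.succ) (fun n => ha n.succ) fun n => hl n.succ
      have ihm := hν.contraction hm (fun n => hψ n.succ) (fun n => ha n.succ) fun n => hl n.succ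
      have ip := hν.integrable_ciSup₂ hp (fun n => ha n.succ) 2
      have im := hν.integrable_ciSup₂ hm (fun n => ha n.succ) 2
      rw [signAvg_succ, integral_pi_succ_symm _ hi]
      simp only [Fin.sum_univ_succ (n := N), Fin.cons_zero, Fin.cons_succ, sgn, ↓reduceIte,
        one_mul, neg_mul, ← add_assoc, Bool.false_eq_true] at ihp ihm ⊢
      refine (mul_le_mul_of_nonneg_left (add_le_add ihp ihm) (by norm_num)).trans ?_
      rw [← integral_add ip im, ← integral_const_mul]
      refine integral_mono ((ip.add im).const_mul _) ?_ fun ξ => ?_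
      · have h := ((measurePreserving_cons (Measure.pi fun _ : Fin C => ν)
          N).integrable_comp_of_integrable hi).integral_prod_right
        simpa only [Fin.sum_univ_succ (n := N), Function.comp, Fin.cons_zero, Fin.cons_succ]
          using h
      · have hG' : Bounded fun i => G i + 2 * ∑ n : Fin N, ∑ j, ξ n j * a n.succ j i :=
          hG.add ((Bounded.sum fun n _ => Bounded.sum fun j _ =>
            (ha n.succ j).const_mul (ξ n j)).const_mul 2)
        have hs := hν.contraction_step hG' (ha 0) (hl 0)
        have e1 : ∀ x i, G i + x + 2 * ∑ n : Fin N, ∑ j, ξ n j * a n.succ j i =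
          G i + 2 * (∑ n : Fin N, ∑ j, ξ n j * a n.succ j i) + x := fun x i => by ring
        have e2 : ∀ (ξ' : Fin C → ℝ) i, G i + 2 * (∑ j, ξ' j * a 0 j i +
          ∑ n : Fin N, ∑ j, ξ n j * a n.succ j i) =
          G i + 2 * (∑ n : Fin N, ∑ j, ξ n j * a n.succ j i) + 2 * ∑ j, ξ' j * a 0 j i :=
          fun ξ' i => by ring
        simp only [e1, e2]
        exact hs

end Contraction

/-! ### Lipschitz constant and size of the surrogate loss -/

section Loss

variable {C : ℕ}

lemma antitone_desc (s : Fin C → ℝ) : Antitone (desc s) := fun a b hab => by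
  have := Tuple.monotone_sort (fun i => -s i) hab
  simpa [desc] using this

/-- Sorting preserves both norms, and by the rearrangement inequality the inner product is largest
when both vectors are in the same order. -/
lemma sum_sq_desc_sub_le (s t : Fin C → ℝ) :
    ∑ k, (desc s k - desc t k) ^ 2 ≤ ∑ i, (s i - t i) ^ 2 := by
  set σ := Tuple.sort (fun i => -s i) with hσ
  set τ := Tuple.sort (fun i => -t i) with hτ
  have h1 : ∑ k, desc s k ^ 2 = ∑ i, s i ^ 2 := Equiv.sum_comp σ fun i => s i ^ 2
  have h2 : ∑ k, desc t k ^ 2 = ∑ i, t i ^ 2 := Equiv.sum_comp τ fun i => t i ^ 2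
  have h3 : ∑ i, s i * t i = ∑ k, desc s k * desc t ((σ.trans τ.symm) k) := by
    rw [← Equiv.sum_comp σ fun i => s i * t i]
    refine Finset.sum_congr rfl fun k _ => ?_
    simp [desc, ← hσ, ← hτ]
  have h4 := ((antitone_desc s).monovary (antitone_desc t)).sum_mul_comp_perm_le_sum_mul
    (σ := σ.trans τ.symm)
  rw [← h3] at h4
  simp only [sub_sq, Finset.sum_add_distrib, Finset.sum_sub_distrib, mul_assoc, ← Finset.mul_sum]
  linarith

lemma sum_abs_le_sqrt_card_mul {κ : Type*} [Fintype κ] (A : Finset κ) (x : κ → ℝ) :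
    ∑ i ∈ A, |x i| ≤ √(A.card : ℝ) * √(∑ i, x i ^ 2) := by
  rw [← Real.sqrt_mul (Nat.cast_nonneg _)]
  refine Real.le_sqrt_of_sq_le ((sq_sum_le_card_mul_sum_sq).trans ?_)
  simp only [sq_abs]
  gcongr
  exact A.subset_univ

lemma card_filter_val_lt_le (m : ℕ) :
    ((Finset.univ.filter fun k : Fin C => (k : ℕ) < m).card : ℝ) ≤ m := by
  have : (Finset.univ.filter fun k : Fin C => (k : ℕ) < m).card ≤ (Finset.range m).card :=
    Finset.card_le_card_of_injOn (fun k => (k : ℕ)) (fun k hk => by simpa using hk)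
      (Fin.val_injective.injOn)
  rw [Finset.card_range] at this
  exact_mod_cast this

lemma Weighting.val_nonneg (w : Weighting) (K q : ℕ) : 0 ≤ w.val K q := by
  cases w
  · simp [Weighting.val]
  · simp [Weighting.val]
  · have : ((min K q : ℕ) : ℝ) ≤ K := by exact_mod_cast min_le_left K q
    have h0 : (0 : ℝ) ≤ K := Nat.cast_nonneg K
    have h1 : (0 : ℝ) ≤ (min K q : ℕ) := Nat.cast_nonneg _
    simp only [Weighting.val]
    have h2 : (0 : ℝ) ≤ 2 * K + 1 - (min K q : ℕ) := by linarith
    positivity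

/-- The Lipschitz constant of the surrogate loss for `q` relevant labels and `μ = 1`. -/
noncomputable def lipConst (w : Weighting) (K q : ℕ) : ℝ :=
  ((K + 1) * √(q : ℝ) + q * √((K : ℝ) + 1)) / (w.val K q * K)

lemma lipConst_nonneg (w : Weighting) (K q : ℕ) : 0 ≤ lipConst w K q :=
  div_nonneg (by positivity) (mul_nonneg (w.val_nonneg K q) (Nat.cast_nonneg K))

/-- Each relevant score enters at most K + 1 terms and each of the top entries enters q terms, q
being the label count. Cauchy–Schwarz over the q relevant scores and over the at most K + 1 top
entries yields (K+1)√q and q√(K+1), the latter through nonexpansiveness of sorting. -/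
lemma abs_loss_sub_loss_le {ℓ : ℝ → ℝ} {μ : ℝ≥0} (hℓ : LipschitzWith μ ℓ) (w : Weighting) (K : ℕ)
    (s t : Fin C → ℝ) (y : Labels C) :
    |loss w K ℓ s y - loss w K ℓ t y| ≤
      μ * lipConst w K (count y) * √(∑ i, (s i - t i) ^ 2) := by
  set R := √(∑ i, (s i - t i) ^ 2) with hR
  set A := Finset.univ.filter fun k : Fin C => (k : ℕ) < K + 1 with hA
  have hR0 : 0 ≤ R := Real.sqrt_nonneg _
  have hw : 0 ≤ 1 / (w.val K (count y) * K) :=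
    one_div_nonneg.2 (mul_nonneg (w.val_nonneg _ _) (Nat.cast_nonneg K))
  have hcard : (A.card : ℝ) ≤ K + 1 := by
    exact_mod_cast card_filter_val_lt_le (C := C) (K + 1)
  have h1 : ∑ i ∈ relevant y, |s i - t i| ≤ √(count y : ℝ) * R :=
    sum_abs_le_sqrt_card_mul (relevant y) fun i => s i - t i
  have h2 : ∑ k ∈ A, |desc s k - desc t k| ≤ √((K : ℝ) + 1) * R := by
    refine (sum_abs_le_sqrt_card_mul A fun k => desc s k - desc t k).trans ?_
    gcongr
    exact Real.sqrt_le_sqrt (sum_sq_desc_sub_le s t)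
  have h3 : |∑ i ∈ relevant y, ∑ k ∈ A, (ℓ (s i - desc s k) - ℓ (t i - desc t k))| ≤
      μ * ((K + 1) * (√(count y : ℝ) * R) + count y * (√((K : ℝ) + 1) * R)) := by
    calc _ ≤ ∑ i ∈ relevant y, ∑ k ∈ A, μ * (|s i - t i| + |desc s k - desc t k|) := by
          refine (Finset.abs_sum_le_sum_abs _ _).trans (Finset.sum_le_sum fun i _ => ?_)
          refine (Finset.abs_sum_le_sum_abs _ _).trans (Finset.sum_le_sum fun k _ => ?_)
          have := hℓ.dist_le_mul (s i - desc s k) (t i - desc t k)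
          rw [Real.dist_eq, Real.dist_eq, sub_sub_sub_comm] at this
          exact this.trans (mul_le_mul_of_nonneg_left (abs_sub _ _) μ.2)
      _ = μ * (A.card * (∑ i ∈ relevant y, |s i - t i|) +
            count y * ∑ k ∈ A, |desc s k - desc t k|) := by
          simp only [mul_add, Finset.sum_add_distrib, ← Finset.mul_sum, Finset.sum_const,
            nsmul_eq_mul, count]
      _ ≤ _ := by
          have := Finset.sum_nonneg (s := relevant y) fun i _ => abs_nonneg (s i - t i)
          gcongr
  rw [loss, loss, ← mul_sub, ← Finset.sum_sub_distrib]
  simp only [← Finset.sum_sub_distrib]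
  rw [abs_mul, abs_of_nonneg hw]
  refine (mul_le_mul_of_nonneg_left h3 hw).trans_eq ?_
  rw [lipConst]; ring

lemma continuous_loss {ℓ : ℝ → ℝ} {μ : ℝ≥0} (hℓ : LipschitzWith μ ℓ) (w : Weighting) (K : ℕ)
    (y : Labels C) : Continuous fun s : Fin C → ℝ => loss w K ℓ s y := by
  rw [continuous_iff_continuousAt]
  intro t
  rw [ContinuousAt, tendsto_iff_norm_sub_tendsto_zero]
  refine squeeze_zero (fun _ => norm_nonneg _) (fun s => abs_loss_sub_loss_le hℓ w K s t y) ?_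
  have : Continuous fun s : Fin C → ℝ =>
      μ * lipConst w K (count y) * √(∑ i, (s i - t i) ^ 2) := by fun_prop
  simpa using this.tendsto t

/-- The loss sees ℓ only at differences of scores; this permits replacing ℓ by a globally Lipschitz
extension. -/
lemma loss_congr {ℓ ℓ' : ℝ → ℝ} {s : Fin C → ℝ} (h : ∀ i j, ℓ (s i - s j) = ℓ' (s i - s j))
    (w : Weighting) (K : ℕ) (y : Labels C) : loss w K ℓ s y = loss w K ℓ' s y := by
  simp only [loss, desc, h]

lemma loss_of_count_eq_zero {y : Labels C} (hy : count y = 0) (w : Weighting) (K : ℕ) (ℓ : ℝ → ℝ)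
    (s : Fin C → ℝ) : loss w K ℓ s y = 0 := by
  rw [loss, Finset.card_eq_zero.1 hy, Finset.sum_empty, mul_zero]

/-- The loss has at most q(K+1) terms, each at most M. For `alpha3` the quotient leaves
2(K+1)/(2K+1-q), which is at most K + 1 because 2K + 1 - q ≥ K + 1 ≥ 2. -/
lemma card_div_val_le {K q : ℕ} (hK : 1 ≤ K) (hq : q ≤ K) (w : Weighting) {M : ℝ} (hM : 0 ≤ M) :
    1 / (w.val K q * K) * (q * ((K + 1) * M)) ≤ lossBound w K M := by
  have hK0 : (1 : ℝ) ≤ K := by exact_mod_cast hK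
  have hqK : (q : ℝ) ≤ K := by exact_mod_cast hq
  rcases Nat.eq_zero_or_pos q with rfl | hq0
  · cases w <;> simp only [lossBound, Nat.cast_zero, zero_mul, mul_zero] <;> positivity
  have hq1 : (0 : ℝ) < q := by exact_mod_cast hq0
  have hK1 : (0 : ℝ) < K := by linarith
  cases w <;> simp only [lossBound, Weighting.val, min_eq_right hq]
  · rw [one_mul, one_div, inv_mul_le_iff₀ hK1]
    exact mul_le_mul_of_nonneg_right hqK (by positivity)
  · rw [show 1 / ((q : ℝ) * K) * (q * ((K + 1) * M)) = (K + 1) * M / K by field_simp]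
    exact div_le_self (by positivity) hK0
  · have h2 : (K : ℝ) + 1 ≤ 2 * K + 1 - q := by linarith
    have h3 : (0 : ℝ) < 2 * K + 1 - q := by linarith
    rw [show 1 / ((q : ℝ) * (2 * K + 1 - q) / 2 * K) * (q * ((K + 1) * M)) =
      2 * (K + 1) / (2 * K + 1 - q) * (M / K) by field_simp,
      show ((K : ℝ) + 1) / K * M = (K + 1) * (M / K) by ring]
    have h4 : 2 * ((K : ℝ) + 1) / (2 * K + 1 - q) ≤ K + 1 := by
      rw [div_le_iff₀ h3]
      nlinarith
    exact mul_le_mul_of_nonneg_right h4 (by positivity)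

lemma loss_mem_Icc {ℓ : ℝ → ℝ} {K : ℕ} (hK : 1 ≤ K) (w : Weighting) {M : ℝ} (hM : 0 ≤ M)
    {s : Fin C → ℝ} (h : ∀ i j, ℓ (s i - s j) ∈ Set.Icc 0 M) {y : Labels C} (hy : count y ≤ K) :
    loss w K ℓ s y ∈ Set.Icc 0 (lossBound w K M) := by
  have hw : 0 ≤ 1 / (w.val K (count y) * K) :=
    one_div_nonneg.2 (mul_nonneg (w.val_nonneg _ _) (Nat.cast_nonneg K))
  refine ⟨mul_nonneg hw (Finset.sum_nonneg fun i _ => Finset.sum_nonneg fun k _ => (h _ _).1), ?_⟩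
  refine le_trans (mul_le_mul_of_nonneg_left ?_ hw) (card_div_val_le hK hy w hM)
  rw [← nsmul_eq_mul]
  refine Finset.sum_le_card_nsmul _ _ _ fun i _ => ?_
  refine (Finset.sum_le_card_nsmul _ _ M fun k _ => (h _ _).2).trans ?_
  rw [nsmul_eq_mul]
  gcongr
  exact_mod_cast card_filter_val_lt_le (C := C) (K + 1)

end Loss

/-! ### From the complexity of the scores to that of the losses -/

section Complexity

variable {X : Type u} {C N : ℕ} {ν : Measure ℝ} {F : Set (X → Fin C → ℝ)}
  {S : Fin N → X × Labels C}

/-- `complexity` integrates over the noise of all N points whatever I is, so zeroing the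
coefficients outside I reproduces its integrand up to the factor 2L|I|. -/
lemma integral_ciSup_eq_complexity {I : Finset (Fin N)} (hI : I.Nonempty) {L : ℝ} (hL : 0 ≤ L) :
    ∫ ξ : Fin N → Fin C → ℝ, (⨆ f : F, (0 + 2 * ∑ n, ∑ j, ξ n j *
      (if n ∈ I then L * (f : X → Fin C → ℝ) (S n).1 j else 0)))
      ∂(Measure.pi fun _ => Measure.pi fun _ => ν) = 2 * L * I.card * complexity ν F S I := by
  have hc : (I.card : ℝ) ≠ 0 := by exact_mod_cast hI.card_pos.ne'
  rw [complexity, ← integral_const_mul]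
  congr 1
  ext ξ
  rw [Real.mul_iSup_of_nonneg (by positivity)]
  refine iSup_congr fun f => ?_
  have : ∑ n, ∑ j, ξ n j * (if n ∈ I then L * (f : X → Fin C → ℝ) (S n).1 j else 0) =
      L * ∑ n ∈ I, ∑ j, ξ n j * (f : X → Fin C → ℝ) (S n).1 j := by
    rw [Finset.mul_sum, ← Finset.sum_filter_add_sum_filter_not Finset.univ (· ∈ I),
      Finset.filter_mem_eq_inter, Finset.univ_inter]
    rw [Finset.sum_eq_zero (s := Finset.univ.filter (· ∉ I)) fun n hn => by
      simp [(Finset.mem_filter.1 hn).2], add_zero]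
    refine Finset.sum_congr rfl fun n hn => ?_
    rw [Finset.mul_sum]
    exact Finset.sum_congr rfl fun j _ => by rw [if_pos hn]; ring
  rw [this]
  field_simp
  ring

variable {lo hi : ℝ}

lemma bounded_ite_const_mul_apply (hF : ∀ f ∈ F, ∀ x i, f x i ∈ Set.Icc lo hi) (p : Prop)
    [Decidable p] (L : ℝ) (x : X) (j : Fin C) :
    Bounded fun f : F => if p then L * (f : X → Fin C → ℝ) x j else 0 := by
  split_ifs
  · refine Bounded.const_mul ⟨max |lo| |hi|, fun f => ?_⟩ L
    exact abs_le_max_abs_abs (hF f f.2 x j).1 (hF f f.2 x j).2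
  · exact Bounded.zero

/-- This is contraction applied to ψ = 0, whose left side is 0. -/
lemma complexity_nonneg (hν : ContractionLaw ν) (hN : 1 ≤ N)
    (hF : ∀ f ∈ F, ∀ x i, f x i ∈ Set.Icc lo hi) (hne : F.Nonempty) :
    0 ≤ complexity ν F S Finset.univ := by
  have := hne.to_subtype
  have : Nonempty (Fin N) := ⟨⟨0, hN⟩⟩
  have h := hν.contraction (ι := F) (N := N) (G := fun _ => 0) (ψ := fun _ _ => 0)
    (a := fun n j f => if n ∈ Finset.univ then 1 * (f : X → Fin C → ℝ) (S n).1 j else 0)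
    Bounded.zero (fun _ => Bounded.zero) (fun n j => bounded_ite_const_mul_apply hF _ _ _ _)
    fun n i k => by simp
  rw [integral_ciSup_eq_complexity Finset.univ_nonempty zero_le_one] at h
  simp only [mul_zero, Finset.sum_const_zero, add_zero, ciSup_const, signAvg_const] at h
  have hN0 : (0 : ℝ) < N := by exact_mod_cast hN
  rw [Finset.card_univ, Fintype.card_fin] at h
  by_contra hlt
  push Not at hlt
  nlinarith [mul_neg_of_pos_of_neg hN0 hlt]

/-- With m = N and k = |S_q|, the weight k/m times the block rate B/√k is B/√m times √(k/m): this is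
where √π_q comes from. -/
lemma one_div_mul_card_mul_eq {m k : ℝ} (hm : 0 < m) (hk : 0 < k) (μ L B : ℝ) :
    1 / m * (2 * (μ * L) * k * (B / √k)) = 2 * (B / √m) * μ * (√(k / m) * L) := by
  rw [Real.sqrt_div hk.le]
  have p1 := Real.sqrt_pos.2 hk
  have p2 := Real.sqrt_pos.2 hm
  nth_rw 1 [← Real.sq_sqrt hk.le, ← Real.sq_sqrt hm.le]
  field_simp

/-- The Rademacher complexity of the surrogate losses, under the rate assumption. -/
lemma rad_loss_le (hν : ContractionLaw ν) (hN : 1 ≤ N) {K : ℕ}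
    (hF : ∀ f ∈ F, ∀ x i, f x i ∈ Set.Icc lo hi) (hne : F.Nonempty) {ℓ : ℝ → ℝ} {μ : ℝ≥0}
    (hℓ : LipschitzWith μ ℓ) {w : Weighting} {M B : ℝ}
    {h : F → X × Labels C → ℝ} (hM : ∀ f z, h f z ∈ Set.Icc 0 M)
    (hh : ∀ (f : F) z, count z.2 ≤ K → h f z = loss w K ℓ ((f : X → Fin C → ℝ) z.1) z.2)
    (hS : ∀ n, count (S n).2 ≤ K) (hB : ComplexityRate ν F S K B) :
    rad h S ≤ 2 * (B / √(N : ℝ)) * μ * rate w K S := by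
  have := hne.to_subtype
  have hN0 : (0 : ℝ) < N := by exact_mod_cast hN
  set Q := Finset.Icc 1 K
  -- The losses are cut into blocks of equal label count. The block q = 0 is dropped since the loss
  -- vanishes there.
  let ψ : ℕ → Fin N → F → ℝ := fun q n f => if count (S n).2 = q then h f (S n) else 0
  have hhb : ∀ n, Bounded fun f => h f (S n) := fun n =>
    ⟨M, fun f => by rw [abs_of_nonneg (hM f _).1]; exact (hM f _).2⟩
  have hψb : ∀ q n, Bounded (ψ q n) := fun q n => by
    simp only [ψ]; split_ifs
    exacts [hhb n, Bounded.zero]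
  have hsplit : ∀ n f, h f (S n) = ∑ q ∈ Q, ψ q n f := by
    intro n f
    simp only [ψ]
    rw [Finset.sum_ite_eq]
    split_ifs with hq
    · rfl
    · have : count (S n).2 = 0 := by
        have := hS n
        simp only [Q, Finset.mem_Icc] at hq
        omega
      rw [hh f _ (hS n), loss_of_count_eq_zero this]
  have h1 : rad h S ≤ ∑ q ∈ Q, 1 / (N : ℝ) *
      signAvg fun σ : Fin N → Bool => ⨆ f, (0 + ∑ n, sgn (σ n) * ψ q n f) := by
    simp only [← signAvg_mul]
    rw [← signAvg_sum, rad]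
    refine signAvg_mono fun σ => ciSup_le fun f => ?_
    simp only [signedMean, hsplit, Finset.mul_sum]
    rw [Finset.sum_comm]
    refine Finset.sum_le_sum fun q _ => ?_
    rw [← Finset.mul_sum]
    refine mul_le_mul_of_nonneg_left ?_ (by positivity)
    have hb : Bounded fun f : F => 0 + ∑ n, sgn (σ n) * ψ q n f :=
      Bounded.zero.add (Bounded.sum fun n _ => (hψb q n).const_mul _)
    exact (zero_add _).symm.le.trans (le_ciSup hb.bddAbove f)
  have h2 : ∀ q ∈ Q, 1 / (N : ℝ) *
      signAvg (fun σ : Fin N → Bool => ⨆ f, (0 + ∑ n, sgn (σ n) * ψ q n f)) ≤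
      2 * (B / √(N : ℝ)) * μ * (√(ratio S q) * lipConst w K q) := by
    intro q hq
    set L : ℝ := μ * lipConst w K q with hLdef
    have hL : 0 ≤ L := mul_nonneg μ.2 (lipConst_nonneg _ _ _)
    have hc := hν.contraction (ι := F) (N := N) (G := fun _ => 0) (ψ := ψ q)
      (a := fun n j f => if n ∈ block S q then L * (f : X → Fin C → ℝ) (S n).1 j else 0)
      Bounded.zero (hψb q) (fun n j => bounded_ite_const_mul_apply hF _ _ _ _) fun n f g => by
        by_cases hn : count (S n).2 = q
        · have hn' : n ∈ block S q := by simp [block, hn]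
          simp only [ψ, hn, hn', if_true]
          rw [hh f _ (hS n), hh g _ (hS n)]
          refine (abs_loss_sub_loss_le hℓ w K _ _ _).trans_eq ?_
          simp only [← mul_sub, mul_pow]
          rw [← Finset.mul_sum, Real.sqrt_mul (sq_nonneg L), Real.sqrt_sq hL, hn]
        · simp only [ψ, hn, if_false, sub_self, abs_zero]
          exact Real.sqrt_nonneg _
    -- The rate assumption is silent about empty blocks; there both the proportion and the
    -- contracted supremum are 0.
    rcases (block S q).eq_empty_or_nonempty with he | hne'
    · have h0 : ∀ n, n ∉ block S q := by simp [he]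
      simp only [h0, if_false, mul_zero, Finset.sum_const_zero, add_zero, ciSup_const,
        integral_zero] at hc
      rw [ratio, he]
      simp only [Finset.card_empty, Nat.cast_zero, zero_div, Real.sqrt_zero, zero_mul, mul_zero]
      exact mul_nonpos_of_nonneg_of_nonpos (by positivity) hc
    · rw [integral_ciSup_eq_complexity hne' hL] at hc
      have hcard : (0 : ℝ) < (block S q).card := by exact_mod_cast hne'.card_pos
      have hB' := hB.2 q hq hne'
      calc _ ≤ 1 / (N : ℝ) * (2 * L * (block S q).card * (B / √((block S q).card : ℝ))) := by
            refine mul_le_mul_of_nonneg_left (hc.trans ?_) (by positivity)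
            exact mul_le_mul_of_nonneg_left hB' (mul_nonneg (mul_nonneg zero_le_two hL) hcard.le)
        _ = _ := by
            rw [ratio, hLdef]
            exact one_div_mul_card_mul_eq hN0 hcard _ _ _
  refine (h1.trans (Finset.sum_le_sum h2)).trans_eq ?_
  rw [← Finset.mul_sum]
  rfl

end Complexity

/-! ### Estimates of the rate for exponential and power-law proportions -/

section Rates

variable {X : Type u} {C N K : ℕ} {S : Fin N → X × Labels C}

/-- Both terms of the numerator are at most 2K√q: the first since K + 1 ≤ 2K, the second since
√(K+1) ≤ 2√K and √q ≤ √K. -/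
lemma lipConst_alpha1_le {q : ℕ} (hq1 : 1 ≤ q) (hqK : q ≤ K) :
    lipConst .alpha1 K q ≤ 4 * √(q : ℝ) := by
  have hq : (1 : ℝ) ≤ q := by exact_mod_cast hq1
  have hK : (q : ℝ) ≤ K := by exact_mod_cast hqK
  have hK0 : (0 : ℝ) < K := by linarith
  rw [lipConst, Weighting.val, one_mul, div_le_iff₀ hK0]
  have h1 : √((K : ℝ) + 1) ≤ 2 * √(K : ℝ) := by
    rw [Real.sqrt_le_left (by positivity), mul_pow, Real.sq_sqrt hK0.le]
    linarith
  have h2 : (q : ℝ) = √(q : ℝ) * √(q : ℝ) := (Real.mul_self_sqrt (by linarith)).symm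
  have h3 : √(q : ℝ) ≤ √(K : ℝ) := Real.sqrt_le_sqrt hK
  have h4 : √(K : ℝ) * √(K : ℝ) = K := Real.mul_self_sqrt hK0.le
  have h0 := Real.sqrt_nonneg (q : ℝ)
  have h5 : (q : ℝ) * √((K : ℝ) + 1) ≤ 2 * K * √(q : ℝ) := by
    calc (q : ℝ) * √((K : ℝ) + 1) ≤ √(q : ℝ) * √(K : ℝ) * (2 * √(K : ℝ)) := by
          refine mul_le_mul ?_ h1 (Real.sqrt_nonneg _) (by positivity)
          rw [h2, Real.sqrt_mul_self h0]
          exact mul_le_mul_of_nonneg_left h3 h0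
      _ = 2 * (√(K : ℝ) * √(K : ℝ)) * √(q : ℝ) := by ring
      _ = _ := by rw [h4]
  nlinarith

lemma lipConst_alpha2_le {q : ℕ} (hq1 : 1 ≤ q) (hqK : q ≤ K) :
    lipConst .alpha2 K q ≤ 4 / √(q : ℝ) := by
  have hq : (0 : ℝ) < q := by exact_mod_cast hq1
  have h := lipConst_alpha1_le hq1 hqK
  have e : lipConst .alpha2 K q = lipConst .alpha1 K q / q := by
    rw [lipConst, lipConst, Weighting.val, Weighting.val, min_eq_right hqK, div_div]
    congr 1; ring
  rw [e, div_le_iff₀ hq]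
  refine h.trans_eq ?_
  rw [div_mul_eq_mul_div, mul_div_assoc, Real.div_sqrt]

/-- Since q ≤ K, the factor 2K + 1 - q is at least K, so the third weight is at least K/2 times the
second. -/
lemma lipConst_alpha3_le {q : ℕ} (hq1 : 1 ≤ q) (hqK : q ≤ K) :
    lipConst .alpha3 K q ≤ 2 / K * lipConst .alpha2 K q := by
  have hq : (1 : ℝ) ≤ q := by exact_mod_cast hq1
  have hK : (q : ℝ) ≤ K := by exact_mod_cast hqK
  have hK0 : (0 : ℝ) < K := by linarith
  have hq0 : (0 : ℝ) < q := by linarith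
  rw [lipConst, lipConst, Weighting.val, Weighting.val, min_eq_right hqK, div_mul_div_comm,
    div_le_div_iff₀ (by
      have : (0 : ℝ) < 2 * K + 1 - q := by linarith
      positivity) (by positivity)]
  have : (K : ℝ) * (q * K) ≤ 2 * (q * (2 * K + 1 - q) / 2 * K) := by
    have h1 : (K : ℝ) ≤ 2 * K + 1 - q := by linarith
    have := mul_le_mul_of_nonneg_left h1 (by positivity : 0 ≤ (q : ℝ) * K)
    nlinarith
  have h0 : 0 ≤ ((K : ℝ) + 1) * √(q : ℝ) + q * √((K : ℝ) + 1) := by positivity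
  have := mul_le_mul_of_nonneg_left this h0
  linarith

lemma rate_alpha3_le : rate .alpha3 K S ≤ 2 / K * rate .alpha2 K S := by
  rw [rate, rate, Finset.mul_sum]
  refine Finset.sum_le_sum fun q hq => ?_
  rw [Finset.mem_Icc] at hq
  have := lipConst_alpha3_le hq.1 hq.2
  rw [lipConst, lipConst] at this
  rw [mul_left_comm]
  exact mul_le_mul_of_nonneg_left this (Real.sqrt_nonneg _)

lemma rate_alpha1_le : rate .alpha1 K S ≤ 4 * ∑ q ∈ Finset.Icc 1 K, √(ratio S q) * √(q : ℝ) := by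
  rw [rate, Finset.mul_sum]
  refine Finset.sum_le_sum fun q hq => ?_
  rw [Finset.mem_Icc] at hq
  rw [mul_left_comm]
  exact mul_le_mul_of_nonneg_left (lipConst_alpha1_le hq.1 hq.2) (Real.sqrt_nonneg _)

lemma rate_alpha2_le : rate .alpha2 K S ≤ 4 * ∑ q ∈ Finset.Icc 1 K, √(ratio S q) / √(q : ℝ) := by
  rw [rate, Finset.mul_sum]
  refine Finset.sum_le_sum fun q hq => ?_
  rw [Finset.mem_Icc] at hq
  refine (mul_le_mul_of_nonneg_left (lipConst_alpha2_le hq.1 hq.2) (Real.sqrt_nonneg _)).trans_eq ?_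
  ring

lemma rate_nonneg (w : Weighting) : 0 ≤ rate w K S :=
  Finset.sum_nonneg fun q _ => mul_nonneg (Real.sqrt_nonneg _) (lipConst_nonneg w K q)

lemma ratio_nonneg (q : ℕ) : 0 ≤ ratio S q := by unfold ratio; positivity

lemma sum_ratio_le_one (Q : Finset ℕ) : ∑ q ∈ Q, ratio S q ≤ 1 := by
  simp only [ratio]
  rw [← Finset.sum_div]
  refine div_le_one_of_le₀ ?_ (Nat.cast_nonneg N)
  have h : ∑ q ∈ Q, (block S q).card ≤ N := by
    simp only [block]
    rw [Finset.sum_card_fiberwise_eq_card_filter]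
    exact (Finset.card_filter_le _ _).trans (by simp)
  exact_mod_cast h

lemma sum_Icc_pow_eq {r : ℝ} (h1 : r < 1) (K : ℕ) :
    ∑ q ∈ Finset.Icc 1 K, r ^ q = r * (1 - r ^ K) / (1 - r) := by
  have h : (1 - r) ≠ 0 := by linarith
  induction K with
  | zero => simp
  | succ K ih =>
    rw [Finset.sum_Icc_succ_top (by omega), ih]
    field_simp
    ring

/-- A telescoping argument: the partial sums satisfy U_q ≤ q because r ≤ 1, so r^q/√q ≤ (U_q -
U_{q-1})/√U_q ≤ 2(√U_q - √U_{q-1}). -/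
lemma sum_Icc_pow_div_sqrt_le {r : ℝ} (h0 : 0 < r) (h1 : r < 1) (K : ℕ) :
    ∑ q ∈ Finset.Icc 1 K, r ^ q / √(q : ℝ) ≤ 2 * √(∑ q ∈ Finset.Icc 1 K, r ^ q) := by
  induction K with
  | zero => simp
  | succ K ih =>
    rw [Finset.sum_Icc_succ_top (by omega), Finset.sum_Icc_succ_top (by omega)]
    set U := ∑ q ∈ Finset.Icc 1 K, r ^ q with hU
    have hU0 : 0 ≤ U := Finset.sum_nonneg fun q _ => by positivity
    have hp : 0 < r ^ (K + 1) := by positivity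
    have hUK : U + r ^ (K + 1) ≤ ((K + 1 : ℕ) : ℝ) := by
      rw [hU, ← Finset.sum_Icc_succ_top (by omega)]
      refine (Finset.sum_le_card_nsmul _ _ 1 fun q _ => pow_le_one₀ h0.le h1.le).trans ?_
      simp
    have hs := Real.sqrt_le_sqrt hUK
    have hV : 0 < √(U + r ^ (K + 1)) := Real.sqrt_pos.2 (by linarith)
    have h2 : r ^ (K + 1) / √((K + 1 : ℕ) : ℝ) ≤ r ^ (K + 1) / √(U + r ^ (K + 1)) := by gcongr
    have h3 : r ^ (K + 1) / √(U + r ^ (K + 1)) ≤ 2 * (√(U + r ^ (K + 1)) - √U) := by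
      rw [div_le_iff₀ hV]
      nlinarith [Real.sq_sqrt hU0, Real.sq_sqrt (by linarith : 0 ≤ U + r ^ (K + 1)),
        sq_nonneg (√(U + r ^ (K + 1)) - √U)]
    linarith

/-- For r ≤ 1/2 the geometric sum is at most 2r. For r ≥ 1/2 it may be large, but then the
normalization forces κ to be small: Σ r^{2q} ≥ (r/2) Σ r^q gives κ Σ r^q ≤ 4, and
`sum_Icc_pow_div_sqrt_le` finishes. Thus no negative power of λ appears. -/
lemma sqrt_mul_sum_Icc_le {r κ : ℝ} (h0 : 0 < r) (h1 : r < 1) (hκ : 0 ≤ κ)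
    (hsum : ∑ q ∈ Finset.Icc 1 K, κ * (r ^ q) ^ 2 ≤ 1) :
    √κ * ∑ q ∈ Finset.Icc 1 K, r ^ q / √(q : ℝ) ≤ 8 * max 1 √κ * r := by
  set U := ∑ q ∈ Finset.Icc 1 K, r ^ q with hU
  have hU0 : 0 ≤ U := Finset.sum_nonneg fun q _ => by positivity
  have hK0 : 0 < r ^ K := by positivity
  have hm1 : 1 ≤ max 1 √κ := le_max_left _ _
  have h1r : 0 < 1 - r := by linarith
  rcases le_total (1 / 2) r with hr | hr
  · have hUV : r / 2 * U ≤ ∑ q ∈ Finset.Icc 1 K, (r ^ q) ^ 2 := by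
      have e : ∑ q ∈ Finset.Icc 1 K, (r ^ q) ^ 2 = r * (1 + r ^ K) / (1 + r) * U := by
        have := sum_Icc_pow_eq (r := r ^ 2) (by nlinarith) K
        simp only [← pow_mul, mul_comm _ 2]
        simp only [pow_mul]
        rw [this, hU, sum_Icc_pow_eq h1, ← pow_mul, mul_comm 2 K, pow_mul,
          show 1 - r ^ 2 = (1 - r) * (1 + r) by ring]
        field_simp
        ring
      rw [e]
      refine mul_le_mul_of_nonneg_right ?_ hU0
      rw [div_le_div_iff₀ (by norm_num) (by linarith)]
      nlinarith
    have hκU : κ * U ≤ 4 := by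
      rw [← Finset.mul_sum] at hsum
      have := mul_le_mul_of_nonneg_left hUV hκ
      nlinarith [mul_nonneg hκ hU0]
    have h4 : √κ * √U ≤ 2 := by
      rw [← Real.sqrt_mul hκ]
      exact Real.sqrt_le_iff.2 ⟨by norm_num, by linarith⟩
    have := mul_le_mul_of_nonneg_left (sum_Icc_pow_div_sqrt_le h0 h1 K) (Real.sqrt_nonneg κ)
    nlinarith
  · have hT : ∑ q ∈ Finset.Icc 1 K, r ^ q / √(q : ℝ) ≤ 2 * r := by
      calc _ ≤ U := Finset.sum_le_sum fun q hq => by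
            rw [Finset.mem_Icc] at hq
            refine div_le_self (by positivity) (Real.one_le_sqrt.2 ?_)
            exact_mod_cast hq.1
        _ ≤ 2 * r := by
            rw [hU, sum_Icc_pow_eq h1, div_le_iff₀ h1r]
            nlinarith
    have := mul_le_mul_of_nonneg_left hT (Real.sqrt_nonneg κ)
    have h2 : √κ ≤ max 1 √κ := le_max_right _ _
    nlinarith [mul_le_mul_of_nonneg_right h2 h0.le, mul_nonneg (zero_le_one.trans hm1) h0.le]

lemma sum_Icc_mul_exp_le {lam : ℝ} (hlam : 0 < lam) (K : ℕ) :
    ∑ q ∈ Finset.Icc 1 K, Real.exp (-(lam / 2)) ^ q * (q : ℝ) ≤ 16 / lam ^ 2 := by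
  set r := Real.exp (-(lam / 2)) with hr
  have h0 : 0 < r := Real.exp_pos _
  have h1 : r < 1 := Real.exp_lt_one_iff.2 (by linarith)
  have hs := hasSum_coe_mul_geometric_of_norm_lt_one (𝕜 := ℝ) (r := r)
    (by rwa [Real.norm_eq_abs, abs_of_pos h0])
  have h2 : ∑ q ∈ Finset.Icc 1 K, r ^ q * (q : ℝ) ≤ r / (1 - r) ^ 2 := by
    simp only [mul_comm (r ^ _)]
    exact sum_le_hasSum _ (fun q _ => by positivity) hs
  refine h2.trans ?_
  have h1r : 0 < 1 - r := by linarith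
  rw [div_le_div_iff₀ (by positivity) (by positivity)]
  -- With r = y², the inequality exp(λ/4) ≥ 1 + λ/4 gives (λ/4)y ≤ 1 - y ≤ 1 - r; squaring is the
  -- claim.
  set y := Real.exp (-(lam / 4)) with hy
  have hy0 : 0 < y := Real.exp_pos _
  have hry : r = y ^ 2 := by rw [hr, hy, ← Real.exp_nat_mul]; congr 1; push_cast; ring
  have h3 : lam / 4 * y ≤ 1 - y := by
    have h := Real.add_one_le_exp (lam / 4)
    have e : Real.exp (lam / 4) * y = 1 := by rw [hy, ← Real.exp_add]; simp
    nlinarith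
  have h4 : 0 ≤ lam / 4 * y := by positivity
  have h5 : lam / 4 * y ≤ 1 - r := by rw [hry]; nlinarith
  have h6 := mul_self_le_mul_self h4 h5
  rw [hry] at h6 ⊢
  nlinarith

/-- Here r = exp(-λ/2), so √π_q = √κ r^q. The constant 256 is 4·4·16 for `alpha1` and 4·2·32 for
`alpha3`. -/
theorem four_mul_rate_le_expRate (w : Weighting) {lam κ : ℝ} (hK : 1 ≤ K) (hlam : 0 < lam)
    (h : ∀ q ∈ Finset.Icc 1 K, ratio S q = κ * Real.exp (-lam * q)) :
    4 * rate w K S ≤ 256 * max 1 √κ * expRate w K lam := by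
  set r := Real.exp (-(lam / 2)) with hr
  have h0 : 0 < r := Real.exp_pos _
  have h1 : r < 1 := Real.exp_lt_one_iff.2 (by linarith)
  have hK0 : (0 : ℝ) < K := by exact_mod_cast hK
  have hm1 : 1 ≤ max 1 √κ := le_max_left _ _
  have hκ : 0 ≤ κ := by
    have := h 1 (Finset.mem_Icc.2 ⟨le_rfl, hK⟩)
    exact nonneg_of_mul_nonneg_left (this ▸ ratio_nonneg 1) (Real.exp_pos _)
  have hrq : ∀ q : ℕ, Real.exp (-lam * q) = (r ^ q) ^ 2 := fun q => by
    rw [hr, ← Real.exp_nat_mul, ← Real.exp_nat_mul]; congr 1; push_cast; ring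
  have hratio : ∀ q ∈ Finset.Icc 1 K, √(ratio S q) = √κ * r ^ q := fun q hq => by
    rw [h q hq, hrq, Real.sqrt_mul hκ, Real.sqrt_sq (by positivity)]
  have hre : r = 1 / Real.exp (lam / 2) := by rw [hr, Real.exp_neg, one_div]
  have h2 : rate .alpha2 K S ≤ 32 * max 1 √κ * r := by
    refine rate_alpha2_le.trans ?_
    have hsum : ∑ q ∈ Finset.Icc 1 K, κ * (r ^ q) ^ 2 ≤ 1 := by
      rw [← Finset.sum_congr rfl fun q hq => (h q hq).trans (by rw [hrq])]
      exact sum_ratio_le_one _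
    rw [Finset.sum_congr rfl fun q hq => by rw [hratio q hq, mul_div_assoc], ← Finset.mul_sum]
    linarith [sqrt_mul_sum_Icc_le h0 h1 hκ hsum]
  have hmr : 0 ≤ max 1 √κ * r := mul_nonneg (zero_le_one.trans hm1) h0.le
  cases w
  · have h3 : rate .alpha1 K S ≤ 4 * (√κ * (16 / lam ^ 2)) := by
      refine rate_alpha1_le.trans ?_
      refine mul_le_mul_of_nonneg_left ?_ (by norm_num)
      refine le_trans ?_ (mul_le_mul_of_nonneg_left (sum_Icc_mul_exp_le hlam K)
        (Real.sqrt_nonneg κ))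
      rw [Finset.mul_sum]
      refine Finset.sum_le_sum fun q hq => ?_
      rw [hratio q hq, mul_assoc]
      have hq1 : (1 : ℝ) ≤ q := by exact_mod_cast (Finset.mem_Icc.1 hq).1
      have : √(q : ℝ) ≤ q := Real.sqrt_le_iff.2 ⟨by linarith, by nlinarith⟩
      gcongr
    have h4 : √κ * (1 / lam ^ 2) ≤ max 1 √κ * (1 / lam ^ 2) :=
      mul_le_mul_of_nonneg_right (le_max_right _ _) (by positivity)
    have e : √κ * (16 / lam ^ 2) = 16 * (√κ * (1 / lam ^ 2)) := by ring
    simp only [expRate]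
    linarith
  · simp only [expRate]
    rw [← hre]
    linarith
  · simp only [expRate]
    have h3 : rate .alpha3 K S ≤ 2 / K * (32 * max 1 √κ * r) :=
      rate_alpha3_le.trans (mul_le_mul_of_nonneg_left h2 (by positivity))
    have e : 1 / ((K : ℝ) * Real.exp (lam / 2)) = 1 / K * r := by rw [hre]; field_simp
    rw [e]
    refine (mul_le_mul_of_nonneg_left h3 (by norm_num)).trans_eq ?_
    ring

lemma sum_Icc_rpow_le_two {s : ℝ} (hs : 2 ≤ s) (K : ℕ) :
    ∑ q ∈ Finset.Icc 1 K, (q : ℝ) ^ (-s) ≤ 2 := by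
  -- The subtracted term 1/(K+1) makes the induction telescope.
  have h : ∀ K : ℕ, ∑ q ∈ Finset.Icc 1 (K + 1), 1 / (q : ℝ) ^ 2 ≤ 2 - 1 / ((K : ℝ) + 1) := by
    intro K
    induction K with
    | zero => norm_num
    | succ K ih =>
      rw [Finset.sum_Icc_succ_top (by omega)]
      have : 1 / (((K + 1 + 1 : ℕ) : ℝ)) ^ 2 ≤ 1 / (K + 1) - 1 / ((K + 1 : ℕ) + 1) := by
        push_cast
        rw [div_sub_div _ _ (by positivity) (by positivity),
          div_le_div_iff₀ (by positivity) (by positivity)]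
        nlinarith [(Nat.cast_nonneg K : (0 : ℝ) ≤ K)]
      linarith
  rcases K with _ | K
  · simp
  have h1 : ∑ q ∈ Finset.Icc 1 (K + 1), (q : ℝ) ^ (-s) ≤
      ∑ q ∈ Finset.Icc 1 (K + 1), 1 / (q : ℝ) ^ 2 := by
    refine Finset.sum_le_sum fun q hq => ?_
    have hq1 : (1 : ℝ) ≤ q := by exact_mod_cast (Finset.mem_Icc.1 hq).1
    refine (Real.rpow_le_rpow_of_exponent_le hq1 (by linarith : -s ≤ -2)).trans_eq ?_
    rw [Real.rpow_neg (by linarith), one_div]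
    norm_num
  have h2 : (0 : ℝ) ≤ 1 / ((K : ℝ) + 1) := by positivity
  linarith [h K]

/-- The harmonic sum is at most 1 + log K, and K ≥ 2 gives 1 ≤ 2 log K because log 2 > 1/2. -/
lemma sum_Icc_rpow_le_log {s : ℝ} (hs : 1 ≤ s) (hK : 2 ≤ K) :
    ∑ q ∈ Finset.Icc 1 K, (q : ℝ) ^ (-s) ≤ 3 * Real.log K := by
  have h1 : ∑ q ∈ Finset.Icc 1 K, (q : ℝ) ^ (-s) ≤ ∑ q ∈ Finset.Icc 1 K, (q : ℝ)⁻¹ := by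
    refine Finset.sum_le_sum fun q hq => ?_
    have hq1 : (1 : ℝ) ≤ q := by exact_mod_cast (Finset.mem_Icc.1 hq).1
    refine (Real.rpow_le_rpow_of_exponent_le hq1 (by linarith : -s ≤ -1)).trans_eq ?_
    rw [Real.rpow_neg_one]
  have h2 := harmonic_le_one_add_log K
  rw [harmonic_eq_sum_Icc] at h2
  push_cast at h2
  have h3 : Real.log 2 ≤ Real.log K := Real.log_le_log (by norm_num) (by exact_mod_cast hK)
  have h4 := Real.log_two_gt_d9
  linarith

/-- For s ≤ 0 the last term is the largest, giving constant 1. For 0 ≤ s < 1 Bernoulli's inequality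
compares each term with an increment of x^(1-s)/(1-s), giving constant 1/(1-s). -/
lemma sum_Icc_rpow_le_rpow {s : ℝ} (hs : s < 1) (K : ℕ) :
    ∑ q ∈ Finset.Icc 1 K, (q : ℝ) ^ (-s) ≤ (1 + (1 - s)⁻¹) * (K : ℝ) ^ (1 - s) := by
  have hp : 0 < 1 - s := by linarith
  rcases le_total s 0 with h0 | h0
  · rcases K with _ | K
    · simp only [Finset.Icc_eq_empty (by norm_num : ¬ 1 ≤ 0), Finset.sum_empty]
      positivity
    have h1 : ∑ q ∈ Finset.Icc 1 (K + 1), (q : ℝ) ^ (-s) ≤ ((K + 1 : ℕ) : ℝ) ^ (1 - s) := by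
      refine (Finset.sum_le_card_nsmul _ _ (((K + 1 : ℕ) : ℝ) ^ (-s)) fun q hq => ?_).trans ?_
      · refine Real.rpow_le_rpow (Nat.cast_nonneg q) ?_ (by linarith)
        exact_mod_cast (Finset.mem_Icc.1 hq).2
      · rw [Nat.card_Icc, nsmul_eq_mul, sub_eq_add_neg, Real.rpow_add (by positivity),
          Real.rpow_one]
        simp
    have h2 : 0 ≤ (1 - s)⁻¹ * ((K + 1 : ℕ) : ℝ) ^ (1 - s) := by positivity
    linarith
  · have h1 : ∑ q ∈ Finset.Icc 1 K, (q : ℝ) ^ (-s) ≤ (1 - s)⁻¹ * (K : ℝ) ^ (1 - s) := by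
      induction K with
      | zero =>
        simp only [Finset.Icc_eq_empty (by norm_num : ¬ 1 ≤ 0), Finset.sum_empty]
        positivity
      | succ K ih =>
        rw [Finset.sum_Icc_succ_top (by omega)]
        have hx : (0 : ℝ) < (K + 1 : ℕ) := by positivity
        set x : ℝ := ((K + 1 : ℕ) : ℝ) with hxdef
        have hKx : (K : ℝ) = x * (1 + -(1 / x)) := by
          rw [mul_add, mul_neg, mul_one_div_cancel hx.ne', hxdef]; push_cast; ring
        have hx1 : 1 / x ≤ 1 := by
          rw [div_le_one hx, hxdef]
          exact_mod_cast Nat.succ_le_succ (Nat.zero_le K)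
        have hb := rpow_one_add_le_one_add_mul_self (s := -(1 / x)) (p := 1 - s)
          (by linarith) hp.le (by linarith)
        have h2 : (K : ℝ) ^ (1 - s) ≤ x ^ (1 - s) - (1 - s) * x ^ (-s) := by
          rw [hKx, Real.mul_rpow hx.le (by linarith)]
          refine (mul_le_mul_of_nonneg_left hb (by positivity)).trans_eq ?_
          have : x ^ (1 - s) = x * x ^ (-s) := by
            rw [sub_eq_add_neg, Real.rpow_add hx, Real.rpow_one]
          rw [this]
          field_simp
          ring
        have h3 := mul_le_mul_of_nonneg_left h2 (inv_nonneg.2 hp.le)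
        rw [mul_sub, inv_mul_cancel_left₀ hp.ne'] at h3
        linarith
    have h2 : 0 ≤ (K : ℝ) ^ (1 - s) := by positivity
    linarith

/-- The constant in the bounds for power laws. -/
noncomputable def powConst (lam : ℝ≥0∞) : ℝ :=
  -- The poles sit at the edges of the polynomial regimes. At λ = 1 the first inverse is 0 by
  -- convention, harmlessly: the second and third weightings are logarithmic there, and the first
  -- uses only the other inverse.
  if 3 ≤ lam then 96 else 96 * (1 + |1 - lam.toReal|⁻¹ + |3 - lam.toReal|⁻¹)

lemma le_powConst (lam : ℝ≥0∞) : 96 ≤ powConst lam := by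
  rw [powConst]
  split_ifs
  · exact le_rfl
  · have h1 : 0 ≤ |1 - lam.toReal|⁻¹ := by positivity
    have h2 : 0 ≤ |3 - lam.toReal|⁻¹ := by positivity
    linarith

lemma antitoneOn_powConst : AntitoneOn powConst (Set.Ici 3) := fun a ha b hb _ => by
  rw [powConst, powConst, if_pos (Set.mem_Ici.1 ha), if_pos (Set.mem_Ici.1 hb)]

lemma powWeight_one (lam : ℝ≥0∞) : powWeight lam 1 = 1 := by
  simp [powWeight]

/-- The summand is q^(-s) with s = (λ-1)/2, so the thresholds s = 1 and s = 2 become λ = 3 and λ =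
5. The factor 32 leaves room for 4 from the risk bound and 4 from `rate_alpha1_le`. -/
lemma sum_powWeight_mul_sqrt_le (hK : 2 ≤ K) (lam : ℝ≥0∞) :
    32 * ∑ q ∈ Finset.Icc 1 K, √(powWeight lam q) * √(q : ℝ) ≤
      powConst lam * powRate .alpha1 K lam := by
  have hK1 : (2 : ℝ) ≤ K := by exact_mod_cast hK
  have hlog : 0 ≤ Real.log K := Real.log_nonneg (by linarith)
  have hc := le_powConst lam
  by_cases ht : lam = ∞
  · subst ht
    have e : ∑ q ∈ Finset.Icc 1 K, √(powWeight ∞ q) * √(q : ℝ) = 1 := by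
      rw [Finset.sum_eq_single_of_mem 1 (Finset.mem_Icc.2 ⟨le_rfl, by omega⟩) fun q _ hq => by
        simp [powWeight, hq]]
      simp [powWeight]
    rw [e, powRate, if_neg (by simp), if_neg (by simp)]
    linarith
  set a := lam.toReal with ha
  have hla : lam = ENNReal.ofReal a := (ENNReal.ofReal_toReal ht).symm
  have e : ∑ q ∈ Finset.Icc 1 K, √(powWeight lam q) * √(q : ℝ) =
      ∑ q ∈ Finset.Icc 1 K, (q : ℝ) ^ (-((a - 1) / 2)) := by
    refine Finset.sum_congr rfl fun q hq => ?_
    have hq0 : (0 : ℝ) < q := by exact_mod_cast (Finset.mem_Icc.1 hq).1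
    rw [powWeight, if_neg ht, Real.sqrt_eq_rpow, Real.sqrt_eq_rpow, ← Real.rpow_mul hq0.le,
      ← Real.rpow_add hq0]
    congr 1; ring
  have hlt : ∀ n : ℕ, n ≠ 0 → (lam < (n : ℝ≥0∞) ↔ a < n) := fun n hn => by
    rw [hla, ← ENNReal.ofReal_natCast, ENNReal.ofReal_lt_ofReal_iff (by positivity)]
  have h3 := hlt 3 (by norm_num)
  have h5 := hlt 5 (by norm_num)
  push_cast at h3 h5
  rw [e, powRate]
  split_ifs with c3 c5
  · have := sum_Icc_rpow_le_rpow (s := (a - 1) / 2) (by linarith [h3.1 c3]) K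
    have e2 : 1 - (a - 1) / 2 = (3 - a) / 2 := by ring
    rw [e2] at this
    have hp : 0 ≤ (K : ℝ) ^ ((3 - a) / 2) := by positivity
    refine (mul_le_mul_of_nonneg_left this (by norm_num)).trans ?_
    rw [← mul_assoc]
    refine mul_le_mul_of_nonneg_right ?_ hp
    rw [powConst, if_neg (not_le.2 c3), ← ha, abs_of_pos (by linarith [h3.1 c3] : 0 < 3 - a),
      inv_div, div_eq_mul_inv]
    have u1 : 0 ≤ |1 - a|⁻¹ := by positivity
    have u2 : 0 ≤ (3 - a)⁻¹ := inv_nonneg.2 (by linarith [h3.1 c3])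
    linarith
  · have := sum_Icc_rpow_le_log (s := (a - 1) / 2)
      (by have := not_lt.1 (mt h3.2 c3); linarith) hK
    nlinarith
  · have := sum_Icc_rpow_le_two (s := (a - 1) / 2)
      (by have := not_lt.1 (mt h5.2 c5); linarith) K
    linarith

/-- Now s = (λ+1)/2, with thresholds λ = 1 and λ = 3. The factor 32 is 4·4·2, the last 2 being
needed for `alpha3`. -/
lemma sum_powWeight_div_sqrt_le (hK : 2 ≤ K) (lam : ℝ≥0∞) :
    32 * ∑ q ∈ Finset.Icc 1 K, √(powWeight lam q) / √(q : ℝ) ≤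
      powConst lam * powRate .alpha2 K lam := by
  have hK1 : (2 : ℝ) ≤ K := by exact_mod_cast hK
  have hlog : 0 ≤ Real.log K := Real.log_nonneg (by linarith)
  have hc := le_powConst lam
  by_cases ht : lam = ∞
  · subst ht
    have e : ∑ q ∈ Finset.Icc 1 K, √(powWeight ∞ q) / √(q : ℝ) = 1 := by
      rw [Finset.sum_eq_single_of_mem 1 (Finset.mem_Icc.2 ⟨le_rfl, by omega⟩) fun q _ hq => by
        simp [powWeight, hq]]
      simp [powWeight]
    rw [e, powRate, if_neg (by simp), if_neg (by simp)]
    linarith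
  set a := lam.toReal with ha
  have hla : lam = ENNReal.ofReal a := (ENNReal.ofReal_toReal ht).symm
  have e : ∑ q ∈ Finset.Icc 1 K, √(powWeight lam q) / √(q : ℝ) =
      ∑ q ∈ Finset.Icc 1 K, (q : ℝ) ^ (-((a + 1) / 2)) := by
    refine Finset.sum_congr rfl fun q hq => ?_
    have hq0 : (0 : ℝ) < q := by exact_mod_cast (Finset.mem_Icc.1 hq).1
    rw [powWeight, if_neg ht, Real.sqrt_eq_rpow, Real.sqrt_eq_rpow, ← Real.rpow_mul hq0.le,
      ← Real.rpow_sub hq0]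
    congr 1; ring
  have hlt : ∀ n : ℕ, n ≠ 0 → (lam < (n : ℝ≥0∞) ↔ a < n) := fun n hn => by
    rw [hla, ← ENNReal.ofReal_natCast, ENNReal.ofReal_lt_ofReal_iff (by positivity)]
  have h1 := hlt 1 (by norm_num)
  have h3 := hlt 3 (by norm_num)
  push_cast at h1 h3
  rw [e, powRate]
  split_ifs with c1 c3
  · have := sum_Icc_rpow_le_rpow (s := (a + 1) / 2) (by linarith [h1.1 c1]) K
    have e2 : 1 - (a + 1) / 2 = (1 - a) / 2 := by ring
    rw [e2] at this
    have hp : 0 ≤ (K : ℝ) ^ ((1 - a) / 2) := by positivity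
    refine (mul_le_mul_of_nonneg_left this (by norm_num)).trans ?_
    rw [← mul_assoc]
    refine mul_le_mul_of_nonneg_right ?_ hp
    have c3 : ¬ 3 ≤ lam := not_le.2 (h3.2 (by linarith [h1.1 c1]))
    rw [powConst, if_neg c3, ← ha, abs_of_pos (by linarith [h1.1 c1] : 0 < 1 - a),
      inv_div, div_eq_mul_inv]
    have u1 : 0 ≤ |3 - a|⁻¹ := by positivity
    have u2 : 0 ≤ (1 - a)⁻¹ := inv_nonneg.2 (by linarith [h1.1 c1])
    linarith
  · have := sum_Icc_rpow_le_log (s := (a + 1) / 2)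
      (by have := not_lt.1 (mt h1.2 c1); linarith) hK
    nlinarith
  · have := sum_Icc_rpow_le_two (s := (a + 1) / 2)
      (by have := not_lt.1 (mt h3.2 c3); linarith) K
    linarith

lemma powRate_alpha3 (hK : 1 ≤ K) (lam : ℝ≥0∞) :
    powRate .alpha3 K lam = (K : ℝ)⁻¹ * powRate .alpha2 K lam := by
  have hK0 : (0 : ℝ) < K := by exact_mod_cast hK
  simp only [powRate]
  split_ifs
  · rw [← Real.rpow_neg_one, ← Real.rpow_add hK0]
    congr 1; ring
  · rfl
  · rw [mul_one]

theorem four_mul_rate_le_powRate (w : Weighting) {lam : ℝ≥0∞} {κ : ℝ} (hK : 2 ≤ K)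
    (h : ∀ q ∈ Finset.Icc 1 K, ratio S q = κ * powWeight lam q) :
    4 * rate w K S ≤ powConst lam * powRate w K lam := by
  have hK0 : (0 : ℝ) < K := by positivity
  -- The weight at q = 1 is 1, so κ is itself the proportion π_1 and can be dropped.
  have hκ1 : κ ≤ 1 := by
    have h1 := h 1 (Finset.mem_Icc.2 ⟨le_rfl, by omega⟩)
    rw [powWeight_one, mul_one] at h1
    rw [← h1]
    simpa using sum_ratio_le_one (S := S) {1}
  have hw : ∀ q, 0 ≤ powWeight lam q := fun q => by
    rw [powWeight]; split_ifs <;> positivity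
  have hr : ∀ q ∈ Finset.Icc 1 K, √(ratio S q) ≤ √(powWeight lam q) := fun q hq => by
    rw [h q hq]
    exact Real.sqrt_le_sqrt (mul_le_of_le_one_left (hw q) hκ1)
  have h2 : 8 * rate .alpha2 K S ≤ powConst lam * powRate .alpha2 K lam := by
    refine le_trans ?_ (sum_powWeight_div_sqrt_le hK lam)
    have : ∑ q ∈ Finset.Icc 1 K, √(ratio S q) / √(q : ℝ) ≤
        ∑ q ∈ Finset.Icc 1 K, √(powWeight lam q) / √(q : ℝ) :=
      Finset.sum_le_sum fun q hq => div_le_div_of_nonneg_right (hr q hq) (Real.sqrt_nonneg _)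
    linarith [rate_alpha2_le (K := K) (S := S)]
  cases w
  · refine le_trans ?_ (sum_powWeight_mul_sqrt_le hK lam)
    have : ∑ q ∈ Finset.Icc 1 K, √(ratio S q) * √(q : ℝ) ≤
        ∑ q ∈ Finset.Icc 1 K, √(powWeight lam q) * √(q : ℝ) :=
      Finset.sum_le_sum fun q hq => mul_le_mul_of_nonneg_right (hr q hq) (Real.sqrt_nonneg _)
    linarith [rate_alpha1_le (K := K) (S := S), rate_nonneg (K := K) (S := S) .alpha1]
  · linarith [rate_nonneg (K := K) (S := S) .alpha2]
  · rw [powRate_alpha3 (by omega)]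
    have h3 := mul_le_mul_of_nonneg_left h2 (inv_nonneg.2 hK0.le)
    have h4 := rate_alpha3_le (K := K) (S := S)
    rw [div_eq_mul_inv] at h4
    linarith

end Rates

/-! ### Assembly of the risk bound -/

section RiskBound

variable {X : Type u} {C N K : ℕ} {ν : Measure ℝ} {F : Set (X → Fin C → ℝ)}
  {S : Fin N → X × Labels C}

/-- The version with a lower bound follows from B/√N = (B/b)(b/√N) ≤ (B/b) · `complexity`.
Nonnegativity of the complexity supplies B ≥ 0, which this step needs. -/
lemma riskBound_of_rate_le [MeasurableSpace X] {D : Measure (X × Labels C)} {w : Weighting} {ℓ : ℝ → ℝ} {μ : ℝ≥0}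
    {M δ B c g : ℝ} (hN : 1 ≤ N) (hB : ComplexityRate ν F S K B)
    (h0 : F.Nonempty → 0 ≤ complexity ν F S Finset.univ)
    (h : ∀ f ∈ F, risk w K ℓ D f ≤
      Phi w K ℓ M δ S f + B / √(N : ℝ) * (4 * μ * rate w K S))
    (hcg : 4 * rate w K S ≤ c * g) : RiskBound ν D F w K ℓ μ M δ S B c g := by
  intro f hf
  have hN0 : (0 : ℝ) < √(N : ℝ) := Real.sqrt_pos.2 (by exact_mod_cast hN)
  have hBN : 0 ≤ B / √(N : ℝ) := (h0 ⟨f, hf⟩).trans hB.1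
  have hμ : (0 : ℝ) ≤ μ := μ.2
  have h1 : 4 * (μ : ℝ) * rate w K S ≤ c * μ * g := by
    have := mul_le_mul_of_nonneg_left hcg hμ
    linarith
  have h2 : 0 ≤ c * (μ : ℝ) * g :=
    le_trans (mul_nonneg (by positivity) (rate_nonneg w)) h1
  have h3 : risk w K ℓ D f ≤ Phi w K ℓ M δ S f + B / √(N : ℝ) * (c * μ * g) :=
    (h f hf).trans (by gcongr)
  refine ⟨fun b hb hbc => h3.trans ?_, h3⟩
  have hB0 : 0 ≤ B := by
    have := mul_nonneg hBN hN0.le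
    rwa [div_mul_cancel₀ _ hN0.ne'] at this
  have e : B / √(N : ℝ) * (c * μ * g) = b / √(N : ℝ) * (c * (B / b) * μ * g) := by
    field_simp
  rw [e]
  have h4 : 0 ≤ c * (B / b) * μ * g := by
    have := mul_nonneg (div_nonneg hB0 hb.le) h2
    linarith
  gcongr

/-- The surrogate loss of a score function, set to `0` where there are more than `K` relevant
labels. -/
noncomputable def truncLoss (w : Weighting) (K : ℕ) (ℓ : ℝ → ℝ) (f : X → Fin C → ℝ)
    (z : X × Labels C) : ℝ :=
  if count z.2 ≤ K then loss w K ℓ (f z.1) z.2 else 0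

lemma measurable_truncLoss [MeasurableSpace X] (w : Weighting) {ℓ : ℝ → ℝ} {μ : ℝ≥0}
    (hℓ : LipschitzWith μ ℓ) {f : X → Fin C → ℝ} (hf : Measurable f) : Measurable (truncLoss w K ℓ f) := by
  refine measurable_from_prod_countable_left fun y => ?_
  unfold truncLoss
  by_cases hy : count y ≤ K
  · simp only [hy, if_true]
    exact (continuous_loss hℓ w K y).measurable.comp hf
  · simp only [hy, if_false]
    exact measurable_const

lemma tendsto_truncLoss (w : Weighting) {ℓ : ℝ → ℝ} {μ : ℝ≥0} (hℓ : LipschitzWith μ ℓ)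
    {g : ℕ → X → Fin C → ℝ} {f : X → Fin C → ℝ}
    (hg : ∀ x, Tendsto (fun m => g m x) atTop (𝓝 (f x))) (z : X × Labels C) :
    Tendsto (fun m => truncLoss w K ℓ (g m) z) atTop (𝓝 (truncLoss w K ℓ f z)) := by
  unfold truncLoss
  by_cases hz : count z.2 ≤ K
  · simp only [hz, if_true]
    exact ((continuous_loss hℓ w K z.2).tendsto _).comp (hg z.1)
  · simp only [hz, if_false]
    exact tendsto_const_nhds

lemma truncLoss_mem_Icc (hK : 1 ≤ K) (w : Weighting) {ℓ : ℝ → ℝ} {M : ℝ} (hM : 0 ≤ M)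
    {f : X → Fin C → ℝ} (h : ∀ x i j, ℓ (f x i - f x j) ∈ Set.Icc 0 M) (z : X × Labels C) :
    truncLoss w K ℓ f z ∈ Set.Icc 0 (lossBound w K M) := by
  unfold truncLoss
  split_ifs with hz
  · exact loss_mem_Icc hK w hM (h z.1) hz
  · refine ⟨le_rfl, ?_⟩
    cases w <;> simp only [lossBound] <;> positivity

lemma ae_forall_pi {Z : Type*} [MeasurableSpace Z] {D : Measure Z} [IsProbabilityMeasure D]
    {p : Z → Prop} (hp : ∀ᵐ z ∂D, p z) :
    ∀ᵐ S ∂(Measure.pi fun _ : Fin N => D), ∀ n, p (S n) :=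
  ae_all_iff.2 fun n => (measurePreserving_eval (fun _ : Fin N => D) n).quasiMeasurePreserving.ae hp

end RiskBound

end TKPR

theorem mainTheorem2 :
    -- `c` is an absolute constant, `c' lam` depends on `lam` only and is uniform for `lam ≥ 3`
    ∃ (c : ℝ) (c' : ℝ≥0∞ → ℝ), 0 < c ∧ AntitoneOn c' (Set.Ici 3) ∧
      ∀ (X : Type u) [MeasurableSpace X] (C N K : ℕ), 1 ≤ N → 1 ≤ K → K < C →
      ∀ (D : Measure (X × TKPR.Labels C)) [IsProbabilityMeasure D],
        (∀ᵐ z ∂D, TKPR.count z.2 ≤ K) →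
      ∀ (lo hi : ℝ) (F : Set (X → Fin C → ℝ)), TKPR.PointwiseMeasurable F →
        (∀ f ∈ F, ∀ x i, f x i ∈ Set.Icc lo hi) →
      ∀ (ℓ : ℝ → ℝ) (μ : ℝ≥0) (M : ℝ), TKPR.SurrogateAssumption ℓ μ M (hi - lo) →
      ∀ (ν : Measure ℝ), (ν = TKPR.rademacher ∨ ν = gaussianReal 0 1) →
      ∀ (w : TKPR.Weighting) (δ : ℝ), 0 < δ → δ < 1 →
        -- the samples for which the assertion fails have probability at most `δ`
        (Measure.pi fun _ : Fin N => D)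
          {S | ¬ ∀ B : ℝ, TKPR.ComplexityRate ν F S K B →
            TKPR.RiskBound ν D F w K ℓ μ M δ S B c (TKPR.rate w K S) ∧
            (∀ lam κ : ℝ, 0 < lam →
              (∀ q ∈ Finset.Icc 1 K, TKPR.ratio S q = κ * Real.exp (-lam * q)) →
              TKPR.RiskBound ν D F w K ℓ μ M δ S B (c * max 1 √κ) (TKPR.expRate w K lam)) ∧
            (2 ≤ K → ∀ (lam : ℝ≥0∞) (κ : ℝ), 0 < lam →
              (∀ q ∈ Finset.Icc 1 K, TKPR.ratio S q = κ * TKPR.powWeight lam q) →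
              TKPR.RiskBound ν D F w K ℓ μ M δ S B (c' lam) (TKPR.powRate w K lam))}
          ≤ ENNReal.ofReal δ := by
  refine ⟨256, TKPR.powConst, by norm_num, TKPR.antitoneOn_powConst, ?_⟩
  intro X _ C N K hN hK hKC D _ hcount lo hi F hF hFr ℓ μ M hℓ ν hν w δ hδ hδ1
  have hν := TKPR.contractionLaw_of_eq hν
  -- ℓ is controlled only on the interval of score differences; its Lipschitz extension agrees with
  -- it there and makes the loss continuous in every score vector.
  obtain ⟨ℓ', hℓ', hext⟩ := hℓ.lipschitz.extend_real
  have hdiff : ∀ f ∈ F, ∀ x i j, f x i - f x j ∈ Set.Icc (-(hi - lo)) (hi - lo) :=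
    fun f hf x i j => by
      obtain ⟨h1, h2⟩ := hFr f hf x i
      obtain ⟨h3, h4⟩ := hFr f hf x j
      exact ⟨by linarith, by linarith⟩
  have hℓ'M : ∀ f ∈ F, ∀ x i j, ℓ' (f x i - f x j) ∈ Set.Icc 0 M := fun f hf x i j => by
    rw [← hext (hdiff f hf x i j)]
    exact ⟨hℓ.nonneg _ (hdiff f hf x i j), hℓ.le_bound _ (hdiff f hf x i j)⟩
  have hloss : ∀ f ∈ F, ∀ z : X × TKPR.Labels C, TKPR.count z.2 ≤ K →
      TKPR.loss w K ℓ (f z.1) z.2 = TKPR.truncLoss w K ℓ' f z := fun f hf z hz => by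
    rw [TKPR.truncLoss, if_pos hz]
    exact TKPR.loss_congr (fun i j => hext (hdiff f hf z.1 i j)) w K z.2
  have hM : ∀ f ∈ F, 0 ≤ M := fun f hf => by
    obtain ⟨z⟩ := nonempty_of_isProbabilityMeasure D
    have h := hℓ'M f hf z.1 ⟨0, by omega⟩ ⟨0, by omega⟩
    exact h.1.trans h.2
  obtain ⟨hmeas, F₀, hF₀, hF₀c, hlim⟩ := hF
  have hmem : ∀ (f : F) z, TKPR.truncLoss w K ℓ' (f : X → Fin C → ℝ) z ∈
      Set.Icc 0 (TKPR.lossBound w K M) := fun f z =>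
    TKPR.truncLoss_mem_Icc hK w (hM f f.2) (hℓ'M f f.2) z
  have hgen := TKPR.measure_lt_integral_le (ι := F) D hN hδ hδ1
    (h := fun f => TKPR.truncLoss w K ℓ' (f : X → Fin C → ℝ)) (s := {f : F | f.1 ∈ F₀})
    (hF₀c.preimage Subtype.val_injective)
    (fun f => TKPR.measurable_truncLoss w hℓ' (hmeas f f.2)) hmem fun f => by
      obtain ⟨g, hg, hgl⟩ := hlim f f.2
      exact ⟨fun m => ⟨g m, hF₀ (hg m)⟩, hg, TKPR.tendsto_truncLoss w hℓ' hgl⟩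
  -- The inclusion of the failure events holds only for almost every sample, namely when all label
  -- counts are at most K.
  refine (measure_mono_ae ?_).trans hgen
  filter_upwards [TKPR.ae_forall_pi (N := N) hcount] with S hS hbad
  by_contra hgood
  refine hbad fun B hB => ?_
  have hrisk : ∀ f ∈ F, TKPR.risk w K ℓ D f ≤
      TKPR.Phi w K ℓ M δ S f + B / √(N : ℝ) * (4 * μ * TKPR.rate w K S) := by
    intro f hf
    have h1 : TKPR.risk w K ℓ D f = ∫ z, TKPR.truncLoss w K ℓ' f z ∂D :=
      integral_congr_ae (hcount.mono fun z hz => hloss f hf z hz)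
    have h2 : TKPR.empRisk w K ℓ S f =
        TKPR.signedMean (fun _ => 1) (TKPR.truncLoss w K ℓ' f) S := by
      simp only [TKPR.empRisk, TKPR.signedMean, one_mul, fun n => hloss f hf (S n) (hS n)]
    have h3 : ∫ z, TKPR.truncLoss w K ℓ' f z ∂D ≤ _ :=
      not_lt.1 fun hlt => hgood ⟨⟨f, hf⟩, hlt⟩
    -- `rad` enters the deviation bound with factor 2 and is itself bounded with factor 2, whence
    -- the 4 in `hrisk`.
    have h4 := TKPR.rad_loss_le hν hN hFr ⟨f, hf⟩ hℓ' hmem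
      (fun f z hz => by rw [TKPR.truncLoss, if_pos hz]) hS hB
    have h5 : √(Real.log (1 / δ) / (2 * N)) ≤ √(Real.log (2 / δ) / (2 * N)) := by
      gcongr
      norm_num
    have h6 : 0 ≤ 3 * TKPR.lossBound w K M :=
      mul_nonneg (by norm_num) (by
        have := hmem ⟨f, hf⟩ (nonempty_of_isProbabilityMeasure D).some
        exact this.1.trans this.2)
    have h7 := mul_le_mul_of_nonneg_left h5 h6
    rw [h1, TKPR.Phi, h2]
    linarith
  have hbound := fun {c g : ℝ} => TKPR.riskBound_of_rate_le (c := c) (g := g) hN hB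
    (TKPR.complexity_nonneg hν hN hFr) hrisk
  refine ⟨hbound ?_, fun lam κ hlam h => hbound ?_, fun hK2 lam κ _ h => hbound ?_⟩
  · linarith [TKPR.rate_nonneg (K := K) (S := S) w]
  · exact TKPR.four_mul_rate_le_expRate w hK hlam h
  · exact TKPR.four_mul_rate_le_powRate w hK2 h
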